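/- Let $X$ be a finite-dimensional real Euclidean vector space and $\Omega\subset X$ a closed convex cone that is pointed ($-\Omega\cap\Omega=0$) and solid ($\Omega-\Omega=X$). Give the set of closed subsets of $X$ the Fell topology (the topology of Painlevé–Kuratowski convergence), let $X$ act on it by translation, $A.x=A+x$, and embed $X$ by $\eta(x)=x-\Omega$. Let $\overline X$ be the closure of $\eta(X)$ and $\overline\Omega$ the closure of $\eta(\Omega)$. The Wiener–Hopf groupoid is the restriction $\mathcal W_\Omega=(\overline X\rtimes X)|\overline\Omega$ of the transformation groupoid, with $r(\omega,x)=\omega$, $s(\omega,x)=\omega+x$ and $(\omega,x)(\omega+x,y)=(\omega,x+y)$. For $A\subset X$ let $A^*=\{x\in X\mid\langle x,a\rangle\ge0\text{ for all }a\in A\}$. Let $P$ be the set of non-void convex faces of $\Omega^*$, a subspace of the space of closed subsets of $X$. For $F\in P$ put $F^\circledast=\operatorname{span}F\cap F^*$. Let $n_0<n_1<\dots<n_d$ be the dimensions of the spans of the faces $F\in P$ and, for $0\le j\le d$, let $P_j=\{F\in P\mid\dim F=n_{d-j}\}$ and $Y_j=\{x-F^*\mid F\in P_j,\ x\in F^\circledast\}$.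 Assume that all the sets $P_j$, $0\le j\le d$, are compact. Then $x-F^*\in\overline\Omega$ for all $F\in P$, $x\in F^\circledast$ (one writes $(F,x)$ for this point), and the following hold. 1. The map $P\to\overline\Omega$, $F\mapsto(F,0)=-F^*$, is a homeomorphism onto a closed set. 2. For $0\le j\le d$, the set $Y_j$ is invariant under $\mathcal W_\Omega$, and $P_j$, identified with its image in $Y_j\subset\overline\Omega$, is an abstract transversal for $\mathcal G_j=\mathcal W_\Omega|Y_j$, i.e. it is a closed subset of the unit space $Y_j$ that meets each orbit, and with $M_j=s^{-1}(P_j)$ the maps $r:M_j\to Y_j$ and $s:M_j\to P_j$ are open. 3. Consequently, with multiplication in $\mathcal W_\Omega$ as left and right action, $M_j$ is a topological equivalence in the sense of Muhly, Renault and Williams between the locally compact Hausdorff groupoids $\mathcal W_\Omega|Y_j$ and $\Sigma_j=\mathcal W_\Omega|P_j$. That is, $M_j$ is locally compact Hausdorff, both actions are free and proper with open moment maps $r$ and $s$, they commute, and $r$, $s$ induce bijections $M_j/\Sigma_j\to Y_j$ and $(\mathcal W_\Omega|Y_j)\backslash M_j\to P_j$. 4. $\Sigma_j$ is a bundle of abelian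 groups with unit space $P_j$ and fibres $F^\perp$: range and source coincide, and $(F,y)\mapsto(-F^*,y)$ is an isomorphism of topological groupoids onto $\Sigma_j$ from the bundle of additive groups $\{(F,y)\mid F\in P_j,\ y\in F^\perp\}$, which has the topology induced from $P_j\times X$. -/

import Mathlib

open Set Topology

/-! ### Closed subsets with the Fell topology -/

/-- The set of closed subsets of a topological space. -/
@[ext]
structure ClosedSubset (X : Type*) [TopologicalSpace X] where
  carrier : Set X
  isClosed' : IsClosed carrier

namespace ClosedSubset

/-- The Fell topology (equivalently, for `X` a finite-dimensional normed space, the topology of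
Painlevé–Kuratowski convergence): it is generated by the sets `{A | A ∩ K = ∅}`, `K` compact, and
`{A | A ∩ U ≠ ∅}`, `U` open. -/
instance fellTopology (X : Type*) [TopologicalSpace X] : TopologicalSpace (ClosedSubset X) :=
  TopologicalSpace.generateFrom
    ({S | ∃ K : Set X, IsCompact K ∧ S = {A | Disjoint A.carrier K}} ∪
      {S | ∃ U : Set X, IsOpen U ∧ S = {A | (A.carrier ∩ U).Nonempty}})

variable {X : Type*} [NormedAddCommGroup X]

/-- Translation `A ↦ A + x` of closed subsets. -/
def translate (x : X) (A : ClosedSubset X) : ClosedSubset X where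
  carrier := {z | z - x ∈ A.carrier}
  isClosed' := A.isClosed'.preimage (continuous_id.sub continuous_const)

instance : AddAction X (ClosedSubset X) where
  vadd := translate
  zero_vadd A := by
    ext z
    change z - 0 ∈ A.carrier ↔ _
    rw [sub_zero]
  add_vadd x y A := by
    ext z
    change z - (x + y) ∈ A.carrier ↔ z - x - y ∈ A.carrier
    rw [sub_sub]

theorem mem_vadd {x z : X} {A : ClosedSubset X} :
    z ∈ (x +ᵥ A).carrier ↔ z - x ∈ A.carrier := Iff.rfl

instance [ProperSpace X] : ContinuousVAdd X (ClosedSubset X) where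
  continuous_vadd := by
    refine continuous_generateFrom_iff.2 ?_
    rintro S (⟨K, hK, rfl⟩ | ⟨U, hU, rfl⟩)
    · rw [isOpen_iff_mem_nhds]
      rintro ⟨x, A⟩ hxA
      have hKx : IsCompact ((fun k => k - x) '' K) :=
        hK.image (continuous_id.sub continuous_const)
      have hdisj : Disjoint ((fun k => k - x) '' K) A.carrier := by
        rw [Set.disjoint_left]
        rintro _ ⟨k, hk, rfl⟩ hkA
        exact Set.disjoint_left.1 hxA (mem_vadd.2 hkA) hk
      obtain ⟨δ, hδ, hd⟩ := hdisj.exists_cthickenings hKx A.isClosed'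
      have hcomp : IsCompact (Metric.cthickening δ ((fun k => k - x) '' K)) := hKx.cthickening
      have hopen : IsOpen {B : ClosedSubset X |
          Disjoint B.carrier (Metric.cthickening δ ((fun k => k - x) '' K))} :=
        TopologicalSpace.isOpen_generateFrom_of_mem (Or.inl ⟨_, hcomp, rfl⟩)
      have hmem : Disjoint A.carrier (Metric.cthickening δ ((fun k => k - x) '' K)) :=
        (hd.mono_right (Metric.self_subset_cthickening _)).symm
      filter_upwards [prod_mem_nhds (Metric.ball_mem_nhds x hδ) (hopen.mem_nhds hmem)]
      rintro ⟨y, B⟩ ⟨hy, hB⟩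
      refine Set.disjoint_left.2 fun k hkB hk => Set.disjoint_left.1 hB (mem_vadd.1 hkB) ?_
      refine Metric.mem_cthickening_of_dist_le _ (k - x) _ _ ⟨k, hk, rfl⟩ ?_
      rw [dist_sub_left]
      exact (Metric.mem_ball.1 hy).le
    · rw [isOpen_iff_mem_nhds]
      rintro ⟨x, A⟩ ⟨z, hzA, hzU⟩
      have hzA' : z - x ∈ A.carrier := hzA
      obtain ⟨ε, hε, hball⟩ := Metric.isOpen_iff.1 hU z hzU
      have hopen : IsOpen {B : ClosedSubset X |
          (B.carrier ∩ Metric.ball (z - x) (ε / 2)).Nonempty} :=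
        TopologicalSpace.isOpen_generateFrom_of_mem (Or.inr ⟨_, Metric.isOpen_ball, rfl⟩)
      have hmem : (A.carrier ∩ Metric.ball (z - x) (ε / 2)).Nonempty :=
        ⟨z - x, hzA', Metric.mem_ball_self (half_pos hε)⟩
      filter_upwards [prod_mem_nhds (Metric.ball_mem_nhds x (half_pos hε)) (hopen.mem_nhds hmem)]
      rintro ⟨y, B⟩ ⟨hy, b, hbB, hb⟩
      refine ⟨b + y, mem_vadd.2 (by simpa using hbB), hball ?_⟩
      have h1 : dist (b + y) (z - x + x) ≤ dist b (z - x) + dist y x := dist_add_add_le _ _ _ _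
      rw [sub_add_cancel] at h1
      rw [Metric.mem_ball] at hb hy ⊢
      linarith

end ClosedSubset

/-! ### Topological groupoids -/

/-- A topological groupoid with arrow space `G` and unit space `U`; the product `g h` of two arrows
is defined when `s g = r h`. -/
structure TopGroupoid (G U : Type*) [TopologicalSpace G] [TopologicalSpace U] where
  r : G → U
  s : G → U
  one : U → G
  inv : G → G
  mul : ∀ g h : G, s g = r h → G
  r_one : ∀ u, r (one u) = u
  s_one : ∀ u, s (one u) = u
  r_inv : ∀ g, r (inv g) = s g
  s_inv : ∀ g, s (inv g) = r g
  r_mul : ∀ g h e, r (mul g h e) = r g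
  s_mul : ∀ g h e, s (mul g h e) = s h
  one_mul : ∀ g, mul (one (r g)) g (s_one _) = g
  mul_one : ∀ g, mul g (one (s g)) (r_one _).symm = g
  inv_mul : ∀ g, mul (inv g) g (s_inv g) = one (s g)
  mul_inv : ∀ g, mul g (inv g) (r_inv g).symm = one (r g)
  mul_assoc : ∀ g h k (e : s g = r h) (e' : s h = r k),
    mul (mul g h e) k ((s_mul g h e).trans e') = mul g (mul h k e') (e.trans (r_mul h k e').symm)
  continuous_r : Continuous r
  continuous_s : Continuous s
  continuous_one : Continuous one
  continuous_inv : Continuous inv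
  continuous_mul : Continuous fun p : {p : G × G // s p.1 = r p.2} => mul p.1.1 p.1.2 p.2

namespace TopGroupoid

/-- The transformation groupoid `T ⋊ X` of an action of an abelian topological group `X` on `T`,
written as a right action `ω.x = x +ᵥ ω`. Its arrows are the pairs `(ω, x)`, with range `ω`, source
`ω.x` and product `(ω, x) (ω.x, y) = (ω, x + y)`. -/
def transformation (X T : Type*) [TopologicalSpace X] [AddCommGroup X] [IsTopologicalAddGroup X]
    [TopologicalSpace T] [AddAction X T] [ContinuousVAdd X T] : TopGroupoid (T × X) T where
  r g := g.1
  s g := g.2 +ᵥ g.1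
  one ω := (ω, 0)
  inv g := (g.2 +ᵥ g.1, -g.2)
  mul g h _ := (g.1, g.2 + h.2)
  r_one _ := rfl
  s_one ω := zero_vadd X ω
  r_inv _ := rfl
  s_inv g := neg_vadd_vadd g.2 g.1
  r_mul _ _ _ := rfl
  s_mul g h e := by
    change (g.2 + h.2) +ᵥ g.1 = h.2 +ᵥ h.1
    rw [← e, add_comm, add_vadd]
  one_mul g := Prod.ext rfl (zero_add _)
  mul_one g := Prod.ext rfl (add_zero _)
  inv_mul g := Prod.ext rfl (neg_add_cancel _)
  mul_inv g := Prod.ext rfl (add_neg_cancel _)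
  mul_assoc g h k _ _ := Prod.ext rfl (add_assoc _ _ _)
  continuous_r := continuous_fst
  continuous_s := continuous_snd.vadd continuous_fst
  continuous_one := by fun_prop
  continuous_inv := (continuous_snd.vadd continuous_fst).prodMk continuous_snd.neg
  continuous_mul := by fun_prop

variable {G U : Type*} [TopologicalSpace G] [TopologicalSpace U]

/-- The restriction (reduction) `𝒢|T` of a groupoid to a set `T` of units: all arrows whose range
and source lie in `T`. -/
def restrict (𝒢 : TopGroupoid G U) (T : Set U) :
    TopGroupoid {g : G // 𝒢.r g ∈ T ∧ 𝒢.s g ∈ T} T where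
  r g := ⟨𝒢.r g.1, g.2.1⟩
  s g := ⟨𝒢.s g.1, g.2.2⟩
  one u := ⟨𝒢.one u.1, by rw [𝒢.r_one]; exact u.2, by rw [𝒢.s_one]; exact u.2⟩
  inv g := ⟨𝒢.inv g.1, by rw [𝒢.r_inv]; exact g.2.2, by rw [𝒢.s_inv]; exact g.2.1⟩
  mul g h e := ⟨𝒢.mul g.1 h.1 (congrArg Subtype.val e),
    by rw [𝒢.r_mul]; exact g.2.1, by rw [𝒢.s_mul]; exact h.2.2⟩
  r_one u := Subtype.ext (𝒢.r_one _)
  s_one u := Subtype.ext (𝒢.s_one _)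
  r_inv g := Subtype.ext (𝒢.r_inv _)
  s_inv g := Subtype.ext (𝒢.s_inv _)
  r_mul _ _ _ := Subtype.ext (𝒢.r_mul _ _ _)
  s_mul _ _ _ := Subtype.ext (𝒢.s_mul _ _ _)
  one_mul _ := Subtype.ext (𝒢.one_mul _)
  mul_one _ := Subtype.ext (𝒢.mul_one _)
  inv_mul _ := Subtype.ext (𝒢.inv_mul _)
  mul_inv _ := Subtype.ext (𝒢.mul_inv _)
  mul_assoc _ _ _ _ _ := Subtype.ext (𝒢.mul_assoc _ _ _ _ _)
  continuous_r := (𝒢.continuous_r.comp continuous_subtype_val).subtype_mk _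
  continuous_s := (𝒢.continuous_s.comp continuous_subtype_val).subtype_mk _
  continuous_one := (𝒢.continuous_one.comp continuous_subtype_val).subtype_mk _
  continuous_inv := (𝒢.continuous_inv.comp continuous_subtype_val).subtype_mk _
  continuous_mul := by
    refine Continuous.subtype_mk (𝒢.continuous_mul.comp
      (g := fun p : {p : G × G // 𝒢.s p.1 = 𝒢.r p.2} => 𝒢.mul p.1.1 p.1.2 p.2)
      (f := fun p : {p : {g : G // 𝒢.r g ∈ T ∧ 𝒢.s g ∈ T} × {g : G // 𝒢.r g ∈ T ∧ 𝒢.s g ∈ T} //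
        (⟨𝒢.s p.1.1, p.1.2.2⟩ : T) = ⟨𝒢.r p.2.1, p.2.2.1⟩} =>
          ⟨(p.1.1.1, p.1.2.1), congrArg Subtype.val p.2⟩) ?_) _
    fun_prop

/-- An isomorphism of topological groupoids, given by homeomorphisms of the arrow and unit
spaces. -/
structure Iso {G' U' : Type*} [TopologicalSpace G'] [TopologicalSpace U']
    (𝒢 : TopGroupoid G U) (𝒢' : TopGroupoid G' U') where
  arrows : G ≃ₜ G'
  units : U ≃ₜ U'
  r_arrows : ∀ g, 𝒢'.r (arrows g) = units (𝒢.r g)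
  s_arrows : ∀ g, 𝒢'.s (arrows g) = units (𝒢.s g)
  arrows_mul : ∀ g h (e : 𝒢.s g = 𝒢.r h), arrows (𝒢.mul g h e) =
    𝒢'.mul (arrows g) (arrows h) (by rw [s_arrows, r_arrows, e])

/-- An abelian group bundle: range and source coincide, and the (isotropy) groups are abelian. -/
structure IsAbelianGroupBundle (𝒢 : TopGroupoid G U) : Prop where
  r_eq_s : ∀ g, 𝒢.r g = 𝒢.s g
  mul_comm : ∀ g h (e : 𝒢.s g = 𝒢.r h) (e' : 𝒢.s h = 𝒢.r g), 𝒢.mul g h e = 𝒢.mul h g e'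

/-- The set `T` of units is invariant. -/
def IsInvariant (𝒢 : TopGroupoid G U) (T : Set U) : Prop :=
  ∀ g, 𝒢.r g ∈ T ↔ 𝒢.s g ∈ T

/-- `𝒢_T = s⁻¹(T)`. -/
abbrev SourceFibre (𝒢 : TopGroupoid G U) (T : Set U) : Type _ := {g : G // 𝒢.s g ∈ T}

/-- `T` is an abstract transversal of `𝒢`: a closed set of units that meets each orbit, such that
`r : 𝒢_T → 𝒢⁰` and `s : 𝒢_T → T` are open maps. -/
structure IsAbstractTransversal (𝒢 : TopGroupoid G U) (T : Set U) : Prop where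
  isClosed : IsClosed T
  meets_orbits : ∀ u, ∃ g, 𝒢.r g = u ∧ 𝒢.s g ∈ T
  isOpenMap_r : IsOpenMap fun g : 𝒢.SourceFibre T => 𝒢.r g.1
  isOpenMap_s : IsOpenMap fun g : 𝒢.SourceFibre T => (⟨𝒢.s g.1, g.2⟩ : T)

/-- A continuous left action of a topological groupoid on a space `Z`. -/
structure LeftAction (𝒢 : TopGroupoid G U) (Z : Type*) [TopologicalSpace Z] where
  moment : Z → U
  act : ∀ (g : G) (z : Z), 𝒢.s g = moment z → Z
  moment_act : ∀ g z e, moment (act g z e) = 𝒢.r g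
  one_act : ∀ z, act (𝒢.one (moment z)) z (𝒢.s_one _) = z
  mul_act : ∀ g h z (e : 𝒢.s g = 𝒢.r h) (e' : 𝒢.s h = moment z),
    act (𝒢.mul g h e) z ((𝒢.s_mul g h e).trans e') =
      act g (act h z e') (e.trans (moment_act h z e').symm)
  continuous_moment : Continuous moment
  continuous_act : Continuous fun p : {p : G × Z // 𝒢.s p.1 = moment p.2} => act p.1.1 p.1.2 p.2

/-- A continuous right action of a topological groupoid on a space `Z`. -/
structure RightAction (𝒢 : TopGroupoid G U) (Z : Type*) [TopologicalSpace Z] where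
  moment : Z → U
  act : ∀ (z : Z) (g : G), moment z = 𝒢.r g → Z
  moment_act : ∀ z g e, moment (act z g e) = 𝒢.s g
  act_one : ∀ z, act z (𝒢.one (moment z)) (𝒢.r_one _).symm = z
  act_mul : ∀ z g h (e : moment z = 𝒢.r g) (e' : 𝒢.s g = 𝒢.r h),
    act z (𝒢.mul g h e') (e.trans (𝒢.r_mul g h e').symm) =
      act (act z g e) h ((moment_act z g e).trans e')
  continuous_moment : Continuous moment
  continuous_act : Continuous fun p : {p : Z × G // moment p.1 = 𝒢.r p.2} => act p.1.1 p.1.2 p.2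

/-- A principal left action: free, and proper, i.e. `(g, z) ↦ (g z, z)` is a proper map. -/
structure LeftAction.IsPrincipal {𝒢 : TopGroupoid G U} {Z : Type*} [TopologicalSpace Z]
    (L : 𝒢.LeftAction Z) : Prop where
  free : ∀ g z e, L.act g z e = z → g = 𝒢.one (L.moment z)
  proper : IsProperMap fun p : {p : G × Z // 𝒢.s p.1 = L.moment p.2} =>
    (L.act p.1.1 p.1.2 p.2, p.1.2)

/-- A principal right action: free, and proper, i.e. `(z, g) ↦ (z g, z)` is a proper map. -/
structure RightAction.IsPrincipal {𝒢 : TopGroupoid G U} {Z : Type*} [TopologicalSpace Z]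
    (R : 𝒢.RightAction Z) : Prop where
  free : ∀ z g e, R.act z g e = z → g = 𝒢.one (R.moment z)
  proper : IsProperMap fun p : {p : Z × G // R.moment p.1 = 𝒢.r p.2} =>
    (R.act p.1.1 p.1.2 p.2, p.1.1)

/-- The space `Z`, with a left `𝒢`-action and a right `ℋ`-action, is an equivalence of the locally
compact groupoids `𝒢` and `ℋ`, in the sense of Muhly, Renault and Williams: all spaces are locally
compact Hausdorff, both actions are principal and have open moment maps, they commute, and the
moment maps induce bijections of `Z / ℋ` onto `𝒢⁰` and of `𝒢 \ Z` onto `ℋ⁰`. -/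
structure IsEquivalence {H V : Type*} [TopologicalSpace H] [TopologicalSpace V]
    (𝒢 : TopGroupoid G U) (ℋ : TopGroupoid H V) {Z : Type*} [TopologicalSpace Z]
    (L : 𝒢.LeftAction Z) (R : ℋ.RightAction Z) : Prop where
  locallyCompact_left : LocallyCompactSpace G ∧ T2Space G
  locallyCompact_right : LocallyCompactSpace H ∧ T2Space H
  locallyCompact : LocallyCompactSpace Z ∧ T2Space Z
  left_principal : L.IsPrincipal
  right_principal : R.IsPrincipal
  isOpenMap_left : IsOpenMap L.moment
  isOpenMap_right : IsOpenMap R.moment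
  left_moment_act : ∀ z h e, L.moment (R.act z h e) = L.moment z
  right_moment_act : ∀ g z e, R.moment (L.act g z e) = R.moment z
  commute : ∀ g z h (e : 𝒢.s g = L.moment z) (e' : R.moment z = ℋ.r h),
    R.act (L.act g z e) h ((right_moment_act g z e).trans e') =
      L.act g (R.act z h e') (e.trans (left_moment_act z h e').symm)
  left_surjective : Function.Surjective L.moment
  left_fibres : ∀ z z', L.moment z = L.moment z' → ∃ h e, R.act z h e = z'
  right_surjective : Function.Surjective R.moment
  right_fibres : ∀ z z', R.moment z = R.moment z' → ∃ g e, L.act g z e = z'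

/-- The left action of `𝒢` on `𝒢_T` by multiplication, with moment map `r`. -/
def leftMul (𝒢 : TopGroupoid G U) (T : Set U) : 𝒢.LeftAction (𝒢.SourceFibre T) where
  moment z := 𝒢.r z.1
  act g z e := ⟨𝒢.mul g z.1 e, by rw [𝒢.s_mul]; exact z.2⟩
  moment_act _ _ _ := 𝒢.r_mul _ _ _
  one_act _ := Subtype.ext (𝒢.one_mul _)
  mul_act _ _ _ _ _ := Subtype.ext (𝒢.mul_assoc _ _ _ _ _)
  continuous_moment := 𝒢.continuous_r.comp continuous_subtype_val
  continuous_act := by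
    refine Continuous.subtype_mk (𝒢.continuous_mul.comp
      (g := fun p : {p : G × G // 𝒢.s p.1 = 𝒢.r p.2} => 𝒢.mul p.1.1 p.1.2 p.2)
      (f := fun p : {p : G × 𝒢.SourceFibre T // 𝒢.s p.1 = 𝒢.r p.2.1} =>
        ⟨(p.1.1, p.1.2.1), p.2⟩) ?_) _
    fun_prop

/-- The right action of `𝒢|T` on `𝒢_T` by multiplication, with moment map `s`. -/
def rightMul (𝒢 : TopGroupoid G U) (T : Set U) :
    (𝒢.restrict T).RightAction (𝒢.SourceFibre T) where
  moment z := ⟨𝒢.s z.1, z.2⟩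
  act z g e := ⟨𝒢.mul z.1 g.1 (congrArg Subtype.val e),
    (𝒢.s_mul z.1 g.1 (congrArg Subtype.val e)).symm ▸ g.2.2⟩
  moment_act _ _ _ := Subtype.ext (𝒢.s_mul _ _ _)
  act_one _ := Subtype.ext (𝒢.mul_one _)
  act_mul z g h e e' := Subtype.ext
    (𝒢.mul_assoc z.1 g.1 h.1 (congrArg Subtype.val e) (congrArg Subtype.val e')).symm
  continuous_moment := (𝒢.continuous_s.comp continuous_subtype_val).subtype_mk _
  continuous_act := by
    refine Continuous.subtype_mk (𝒢.continuous_mul.comp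
      (g := fun p : {p : G × G // 𝒢.s p.1 = 𝒢.r p.2} => 𝒢.mul p.1.1 p.1.2 p.2)
      (f := fun p : {p : 𝒢.SourceFibre T × {g : G // 𝒢.r g ∈ T ∧ 𝒢.s g ∈ T} //
        (⟨𝒢.s p.1.1, p.1.2⟩ : T) = ⟨𝒢.r p.2.1, p.2.2.1⟩} =>
          ⟨(p.1.1.1, p.1.2.1), congrArg Subtype.val p.2⟩) ?_) _
    fun_prop

end TopGroupoid

/-! ### The Wiener–Hopf groupoid of a cone -/

section WienerHopf

variable {X : Type*} [NormedAddCommGroup X] [InnerProductSpace ℝ X] [FiniteDimensional ℝ X]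

/-- The closed set `x - F^*`, where `F^*` is the dual cone of `F`. -/
noncomputable def subDual (x : X) (F : Set X) : ClosedSubset X where
  carrier := {z | x - z ∈ ProperCone.innerDual F}
  isClosed' := (ProperCone.innerDual F).isClosed.preimage (continuous_const.sub continuous_id)

/-- `η(x) = x - Ω`, as a closed subset of `X`. -/
def coneEmbedding (Ω : ProperCone ℝ X) (x : X) : ClosedSubset X where
  carrier := {z | x - z ∈ Ω}
  isClosed' := Ω.isClosed.preimage (continuous_const.sub continuous_id)

/-- The order compactification of `X`: the closure of `η(X)` in the closed subsets of `X`. -/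
def orderCompactification (Ω : ProperCone ℝ X) : Set (ClosedSubset X) :=
  closure (range (coneEmbedding Ω))

theorem vadd_mem_orderCompactification (Ω : ProperCone ℝ X) (x : X)
    {A : ClosedSubset X} (hA : A ∈ orderCompactification Ω) :
    x +ᵥ A ∈ orderCompactification Ω := by
  refine map_mem_closure (continuous_const_vadd x) hA ?_
  rintro _ ⟨y, rfl⟩
  refine ⟨x + y, ?_⟩
  ext z
  change x + y - z ∈ Ω ↔ y - (z - x) ∈ Ω
  rw [show x + y - z = y - (z - x) by abel]

instance (Ω : ProperCone ℝ X) : AddAction X (orderCompactification Ω) where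
  vadd x A := ⟨x +ᵥ A.1, vadd_mem_orderCompactification Ω x A.2⟩
  zero_vadd A := Subtype.ext (zero_vadd X A.1)
  add_vadd x y A := Subtype.ext (add_vadd x y A.1)

instance (Ω : ProperCone ℝ X) : ContinuousVAdd X (orderCompactification Ω) where
  continuous_vadd := Continuous.subtype_mk
    (continuous_fst.vadd (continuous_subtype_val.comp continuous_snd)) _

/-- `Ω̄`, the closure of (the image under `η` of) `Ω` in the order compactification of `X`. -/
def coneClosure (Ω : ProperCone ℝ X) : Set (orderCompactification Ω) :=
  closure {A | ∃ x ∈ Ω, (A : ClosedSubset X) = coneEmbedding Ω x}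

/-- The Wiener–Hopf groupoid: the restriction to `Ω̄` of the transformation groupoid of the action
of `X` by translation on its order compactification. -/
def wienerHopf (Ω : ProperCone ℝ X) :=
  (TopGroupoid.transformation X (orderCompactification Ω)).restrict (coneClosure Ω)

/-- The set `P` of non-void convex faces of the dual cone `Ω^*`, a subspace of the closed subsets of
`X` (convex faces of closed convex sets in finite dimensions are closed). -/
def dualFaces (Ω : ProperCone ℝ X) : Set (ClosedSubset X) :=
  {F | F.carrier.Nonempty ∧ Convex ℝ F.carrier ∧
    IsExtreme ℝ (ProperCone.innerDual (Ω : Set X) : Set X) F.carrier}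

/-- The dimension of the linear span of a set. -/
noncomputable def spanDim (F : Set X) : ℕ := Module.finrank ℝ (Submodule.span ℝ F)

/-- The set `{n_0 < n_1 < ⋯ < n_d}` of the dimensions of the faces of `Ω^*`. -/
def faceDims (Ω : ProperCone ℝ X) : Set ℕ := (fun F => spanDim F.carrier) '' dualFaces Ω

/-- The index `d` of the largest face dimension. -/
noncomputable def faceDepth (Ω : ProperCone ℝ X) : ℕ := (faceDims Ω).ncard - 1

/-- `P_j`, the set of faces of dimension `n_{d-j}`, for `0 ≤ j ≤ d`. -/
def faceStratum (Ω : ProperCone ℝ X) (j : ℕ) : Set (ClosedSubset X) :=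
  {F ∈ dualFaces Ω | spanDim F.carrier = Nat.nth (· ∈ faceDims Ω) (faceDepth Ω - j)}

/-- The relative dual cone `F^⊛ = span F ∩ F^*`. -/
def relDual (F : Set X) : Set X :=
  {x | x ∈ Submodule.span ℝ F ∧ x ∈ ProperCone.innerDual F}

/-- `Y_j = {x - F^* | x ∈ F^⊛, F ∈ P_j}`, as a set of points of `Ω̄`. -/
def unitStratum (Ω : ProperCone ℝ X) (j : ℕ) : Set (coneClosure Ω) :=
  {ω | ∃ F ∈ faceStratum Ω j, ∃ x ∈ relDual F.carrier, ω.1.1 = subDual x F.carrier}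

/-- The image of `P_j` in `Y_j` under `F ↦ (F, 0) = 0 - F^*`. -/
def faceUnits (Ω : ProperCone ℝ X) (j : ℕ) : Set (unitStratum Ω j) :=
  {ω | ∃ F ∈ faceStratum Ω j, ω.1.1.1 = subDual 0 F.carrier}

/-- The restricted groupoid `𝒲_Ω|Y_j`. -/
def stratumGroupoid (Ω : ProperCone ℝ X) (j : ℕ) :=
  (wienerHopf Ω).restrict (unitStratum Ω j)

/-- The bundle of groups `Σ_j = 𝒲_Ω|P_j`. -/
def stratumBundle (Ω : ProperCone ℝ X) (j : ℕ) :=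
  (stratumGroupoid Ω j).restrict (faceUnits Ω j)

/-- The co-tautological bundle of groups over a set `S` of closed subsets of `X`: its fibre at
`F ∈ S` is the additive group `F^⊥`, and it has the topology induced from `S × X`. -/
def perpBundle (S : Set (ClosedSubset X)) :
    TopGroupoid {p : S × X // p.2 ∈ (Submodule.span ℝ p.1.1.carrier)ᗮ} S where
  r g := g.1.1
  s g := g.1.1
  one F := ⟨(F, 0), Submodule.zero_mem _⟩
  inv g := ⟨(g.1.1, -g.1.2), Submodule.neg_mem _ g.2⟩
  mul g h e := ⟨(g.1.1, g.1.2 + h.1.2), Submodule.add_mem _ g.2 (by rw [e]; exact h.2)⟩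
  r_one _ := rfl
  s_one _ := rfl
  r_inv _ := rfl
  s_inv _ := rfl
  r_mul _ _ _ := rfl
  s_mul _ _ e := e
  one_mul _ := Subtype.ext (Prod.ext rfl (zero_add _))
  mul_one _ := Subtype.ext (Prod.ext rfl (add_zero _))
  inv_mul _ := Subtype.ext (Prod.ext rfl (neg_add_cancel _))
  mul_inv _ := Subtype.ext (Prod.ext rfl (add_neg_cancel _))
  mul_assoc _ _ _ _ _ := Subtype.ext (Prod.ext rfl (add_assoc _ _ _))
  continuous_r := by fun_prop
  continuous_s := by fun_prop
  continuous_one := by fun_prop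
  continuous_inv := by fun_prop
  continuous_mul := by fun_prop

end WienerHopf

/-! A point `x - F^*` determines `F`, by the bipolar theorem, and determines `x` up to `F^⊥`, the
lineality space of `F^*`. Taking the representative `x` in `span F` gives coordinates `(F, x)`, `x ∈
F^⊛`, on `Y_j`, in which translation leaves `F` alone. Hence `Y_j` is invariant, every orbit in it
passes through some `(F, 0)`, and an arrow from `(F, 0)` to `(F', 0)` forces `F = F'` and is a
vector of `F^⊥`.

That these points lie in the closure of `Ω` is shown by descending from `Ω^*` to `F` through exposed
faces: translating to infinity along an exposing vector replaces a cone by the exposed face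
(`tendsto_subDual_add_smul`, `IsConvexFace.subDual_mem_of_isClosed`).

The topology rests on two continuity facts. Polarity is continuous on closed convex cones
(`ProperCone.tendsto_subDual_zero`), and among faces of one dimension the projection onto the span
varies continuously (`tendsto_starProjection_span`). Since `P_j` is compact and `x` cannot escape to
infinity while `x - F^*` converges in `Y_j`, the map `(F, x) ↦ x - F^*` is an embedding
(`IsFaceStratum.isEmbedding_subDual`). The maps `r` and `s` are open because every arrow lies on a
section continuous at its image, built from projections onto `span F` and nearest points of `F^*`
(`isAbstractTransversal_faceUnits`). The equivalence is then formal
(`TopGroupoid.IsAbstractTransversal.isEquivalence`). -/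

namespace TopGroupoid

/-! ### Groupoid algebra and the equivalence defined by a transversal -/

variable {G U : Type*} [TopologicalSpace G] [TopologicalSpace U] (𝒢 : TopGroupoid G U)

/-- Composability is a proof depending on both factors, so factors cannot be rewritten in place;
this transports the proof along. -/
theorem mul_congr {g g' h h' : G} (hg : g = g') (hh : h = h') (e : 𝒢.s g = 𝒢.r h) :
    𝒢.mul g h e = 𝒢.mul g' h' (hg ▸ hh ▸ e) := by
  subst hg hh
  rfl

theorem inv_mul_cancel_left (g h : G) (e : 𝒢.s g = 𝒢.r h) :
    𝒢.mul (𝒢.inv g) (𝒢.mul g h e) ((𝒢.s_inv g).trans (𝒢.r_mul g h e).symm) = h := by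
  rw [← 𝒢.mul_assoc _ _ _ (𝒢.s_inv g) e]
  refine (𝒢.mul_congr ((𝒢.inv_mul g).trans (congrArg 𝒢.one e)) rfl _).trans (𝒢.one_mul h)

theorem mul_inv_cancel_right (g h : G) (e : 𝒢.s g = 𝒢.r h) :
    𝒢.mul (𝒢.mul g h e) (𝒢.inv h) ((𝒢.s_mul g h e).trans (𝒢.r_inv h).symm) = g := by
  rw [𝒢.mul_assoc _ _ _ e (𝒢.r_inv h).symm]
  refine (𝒢.mul_congr rfl ((𝒢.mul_inv h).trans (congrArg 𝒢.one e.symm)) _).trans (𝒢.mul_one g)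

theorem mul_inv_cancel_left (g h : G) (e : 𝒢.r g = 𝒢.r h) :
    𝒢.mul g (𝒢.mul (𝒢.inv g) h ((𝒢.s_inv g).trans e))
      ((𝒢.r_inv g).symm.trans (𝒢.r_mul _ _ _).symm) = h := by
  rw [← 𝒢.mul_assoc _ _ _ (𝒢.r_inv g).symm ((𝒢.s_inv g).trans e)]
  refine (𝒢.mul_congr ((𝒢.mul_inv g).trans (congrArg 𝒢.one e)) rfl _).trans (𝒢.one_mul h)

theorem inv_mul_cancel_right (g h : G) (e : 𝒢.s g = 𝒢.s h) :
    𝒢.mul (𝒢.mul g (𝒢.inv h) (e.trans (𝒢.r_inv h).symm)) h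
      ((𝒢.s_mul _ _ _).trans (𝒢.s_inv h)) = g := by
  rw [𝒢.mul_assoc _ _ _ (e.trans (𝒢.r_inv h).symm) (𝒢.s_inv h)]
  refine (𝒢.mul_congr rfl ((𝒢.inv_mul h).trans (congrArg 𝒢.one e.symm)) _).trans (𝒢.mul_one g)

theorem eq_one_of_mul_eq_right (g h : G) (e : 𝒢.s g = 𝒢.r h) (hgh : 𝒢.mul g h e = h) :
    g = 𝒢.one (𝒢.r h) := by
  rw [← 𝒢.mul_inv_cancel_right g h e, ← 𝒢.mul_inv h]
  exact 𝒢.mul_congr hgh rfl _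

theorem eq_one_of_mul_eq_left (g h : G) (e : 𝒢.s g = 𝒢.r h) (hgh : 𝒢.mul g h e = g) :
    h = 𝒢.one (𝒢.s g) := by
  rw [← 𝒢.inv_mul_cancel_left g h e, ← 𝒢.inv_mul g]
  exact 𝒢.mul_congr rfl hgh _

theorem continuous_mul_comp {Z : Type*} [TopologicalSpace Z] {f g : Z → G} (hf : Continuous f)
    (hg : Continuous g) (e : ∀ z, 𝒢.s (f z) = 𝒢.r (g z)) :
    Continuous fun z => 𝒢.mul (f z) (g z) (e z) :=
  𝒢.continuous_mul.comp
    (g := fun p : {p : G × G // 𝒢.s p.1 = 𝒢.r p.2} => 𝒢.mul p.1.1 p.1.2 p.2)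
    (f := fun z => ⟨(f z, g z), e z⟩) (by fun_prop)

/-- A continuous map with a continuous inverse on its closed range is a proper map. -/
theorem _root_.isProperMap_of_leftInverseOn {A B : Type*} [TopologicalSpace A]
    [TopologicalSpace B] {f : A → B} (hf : Continuous f) {S : Set B} (hS : IsClosed S)
    (hfS : ∀ a, f a ∈ S) {k : S → A} (hk : Continuous k) (hl : ∀ a, k ⟨f a, hfS a⟩ = a)
    (hr : ∀ b, f (k b) = b) : IsProperMap f := by
  let e : A ≃ₜ S :=
    { toFun := fun a => ⟨f a, hfS a⟩
      invFun := k
      left_inv := hl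
      right_inv := fun b => Subtype.ext (hr b)
      continuous_toFun := hf.subtype_mk _
      continuous_invFun := hk }
  exact (hS.isClosedEmbedding_subtypeVal.comp e.isClosedEmbedding).isProperMap

/-- The map `(g, z) ↦ (gz, z)` has image `{(z', z) | s z' = s z}`, closed because the unit space is
Hausdorff, and inverse `(z', z) ↦ (z' z⁻¹, z)`, which is continuous. -/
theorem leftMul_isPrincipal [T2Space U] (T : Set U) : (𝒢.leftMul T).IsPrincipal where
  free g z e h := 𝒢.eq_one_of_mul_eq_right g z.1 e (congrArg Subtype.val h)
  proper := by
    have hs : Continuous fun z : 𝒢.SourceFibre T => 𝒢.s z.1 :=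
      𝒢.continuous_s.comp continuous_subtype_val
    refine isProperMap_of_leftInverseOn
      (S := {q : 𝒢.SourceFibre T × 𝒢.SourceFibre T | 𝒢.s q.1.1 = 𝒢.s q.2.1})
      ((𝒢.leftMul T).continuous_act.prodMk (by fun_prop))
      (isClosed_eq (hs.comp continuous_fst) (hs.comp continuous_snd))
      (fun p => 𝒢.s_mul _ _ _)
      (k := fun q => ⟨(𝒢.mul q.1.1.1 (𝒢.inv q.1.2.1) (q.2.trans (𝒢.r_inv _).symm), q.1.2),
        (𝒢.s_mul _ _ _).trans (𝒢.s_inv _)⟩) ?_ ?_ ?_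
    · refine Continuous.subtype_mk (Continuous.prodMk (𝒢.continuous_mul_comp ?_ ?_ _) ?_) _
      · fun_prop
      · exact 𝒢.continuous_inv.comp (by fun_prop)
      · fun_prop
    · rintro ⟨⟨g, z⟩, e⟩
      exact Subtype.ext (Prod.ext (𝒢.mul_inv_cancel_right g z.1 e) rfl)
    · rintro ⟨⟨z', z⟩, e⟩
      exact Prod.ext (Subtype.ext (𝒢.inv_mul_cancel_right z'.1 z.1 e)) rfl

/-- The mirror image: pairs with equal range, and inverse `(z', z) ↦ (z, z⁻¹ z')`. -/
theorem rightMul_isPrincipal [T2Space U] (T : Set U) : (𝒢.rightMul T).IsPrincipal where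
  free z g e h := Subtype.ext
    (𝒢.eq_one_of_mul_eq_left z.1 g.1 (congrArg Subtype.val e) (congrArg Subtype.val h))
  proper := by
    have hr : Continuous fun z : 𝒢.SourceFibre T => 𝒢.r z.1 :=
      𝒢.continuous_r.comp continuous_subtype_val
    refine isProperMap_of_leftInverseOn
      (S := {q : 𝒢.SourceFibre T × 𝒢.SourceFibre T | 𝒢.r q.1.1 = 𝒢.r q.2.1})
      ((𝒢.rightMul T).continuous_act.prodMk (by fun_prop))
      (isClosed_eq (hr.comp continuous_fst) (hr.comp continuous_snd))
      (fun p => 𝒢.r_mul _ _ _)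
      (k := fun q => ⟨(q.1.2, ⟨𝒢.mul (𝒢.inv q.1.2.1) q.1.1.1 ((𝒢.s_inv _).trans q.2.symm),
        by rw [𝒢.r_mul, 𝒢.r_inv]; exact q.1.2.2, by rw [𝒢.s_mul]; exact q.1.1.2⟩),
        Subtype.ext ((𝒢.r_inv _).symm.trans (𝒢.r_mul _ _ _).symm)⟩) ?_ ?_ ?_
    · refine Continuous.subtype_mk (Continuous.prodMk ?_
        (Continuous.subtype_mk (𝒢.continuous_mul_comp ?_ ?_ _) _)) _
      · fun_prop
      · exact 𝒢.continuous_inv.comp (by fun_prop)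
      · fun_prop
    · rintro ⟨⟨z, g⟩, e⟩
      exact Subtype.ext (Prod.ext rfl (Subtype.ext
        (𝒢.inv_mul_cancel_left z.1 g.1 (congrArg Subtype.val e))))
    · rintro ⟨⟨z', z⟩, e⟩
      exact Prod.ext (Subtype.ext (𝒢.mul_inv_cancel_left z.1 z'.1 e.symm)) rfl

/-- An abstract transversal of a locally compact Hausdorff groupoid implements an equivalence of
the groupoid with its restriction to the transversal. -/
theorem IsAbstractTransversal.isEquivalence {𝒢 : TopGroupoid G U} {T : Set U}
    (hT : 𝒢.IsAbstractTransversal T) [LocallyCompactSpace G] [T2Space G] [T2Space U] :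
    IsEquivalence 𝒢 (𝒢.restrict T) (𝒢.leftMul T) (𝒢.rightMul T) where
  locallyCompact_left := ⟨inferInstance, inferInstance⟩
  locallyCompact_right := by
    have h : IsClosed {g : G | 𝒢.r g ∈ T ∧ 𝒢.s g ∈ T} :=
      (hT.isClosed.preimage 𝒢.continuous_r).inter (hT.isClosed.preimage 𝒢.continuous_s)
    exact ⟨h.isClosedEmbedding_subtypeVal.locallyCompactSpace, inferInstance⟩
  locallyCompact := by
    have h : IsClosed {g : G | 𝒢.s g ∈ T} := hT.isClosed.preimage 𝒢.continuous_s
    exact ⟨h.isClosedEmbedding_subtypeVal.locallyCompactSpace, inferInstance⟩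
  left_principal := 𝒢.leftMul_isPrincipal T
  right_principal := 𝒢.rightMul_isPrincipal T
  isOpenMap_left := hT.isOpenMap_r
  isOpenMap_right := hT.isOpenMap_s
  left_moment_act _ _ _ := 𝒢.r_mul _ _ _
  right_moment_act _ _ _ := Subtype.ext (𝒢.s_mul _ _ _)
  commute _ _ _ _ _ := Subtype.ext (𝒢.mul_assoc _ _ _ _ _)
  left_surjective u := by
    obtain ⟨g, hg, hgT⟩ := hT.meets_orbits u
    exact ⟨⟨g, hgT⟩, hg⟩
  left_fibres z z' e := by
    have e' : 𝒢.r z.1 = 𝒢.r z'.1 := e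
    exact ⟨⟨𝒢.mul (𝒢.inv z.1) z'.1 ((𝒢.s_inv _).trans e'),
      by rw [𝒢.r_mul, 𝒢.r_inv]; exact z.2, by rw [𝒢.s_mul]; exact z'.2⟩,
      Subtype.ext ((𝒢.r_inv _).symm.trans (𝒢.r_mul _ _ _).symm),
      Subtype.ext (𝒢.mul_inv_cancel_left z.1 z'.1 e')⟩
  right_surjective u := ⟨⟨𝒢.one u.1, by rw [𝒢.s_one]; exact u.2⟩, Subtype.ext (𝒢.s_one _)⟩
  right_fibres z z' e := by
    have e' : 𝒢.s z'.1 = 𝒢.s z.1 := (congrArg Subtype.val e).symm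
    exact ⟨𝒢.mul z'.1 (𝒢.inv z.1) (e'.trans (𝒢.r_inv _).symm),
      (𝒢.s_mul _ _ _).trans (𝒢.s_inv _), Subtype.ext (𝒢.inv_mul_cancel_right z'.1 z.1 e')⟩

end TopGroupoid

section ConeFaces

open Filter
open scoped RealInnerProductSpace NNReal

/-! ### Convergence in the Fell topology, and closed convex cones -/

namespace ClosedSubset

section Basic

variable {X : Type*} [TopologicalSpace X]

theorem isOpen_miss {K : Set X} (hK : IsCompact K) :
    IsOpen {A : ClosedSubset X | Disjoint A.carrier K} :=
  TopologicalSpace.isOpen_generateFrom_of_mem (Or.inl ⟨K, hK, rfl⟩)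

theorem isOpen_hit {U : Set X} (hU : IsOpen U) :
    IsOpen {A : ClosedSubset X | (A.carrier ∩ U).Nonempty} :=
  TopologicalSpace.isOpen_generateFrom_of_mem (Or.inr ⟨U, hU, rfl⟩)

theorem isClosed_mem (x : X) : IsClosed {A : ClosedSubset X | x ∈ A.carrier} := by
  have h := isOpen_miss (X := X) (isCompact_singleton (x := x))
  convert h.isClosed_compl using 1
  ext A
  simp

theorem tendsto_iff {α : Type*} {l : Filter α} {A : α → ClosedSubset X} {B : ClosedSubset X} :
    Tendsto A l (𝓝 B) ↔
      (∀ K, IsCompact K → Disjoint B.carrier K → ∀ᶠ a in l, Disjoint (A a).carrier K) ∧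
      (∀ U, IsOpen U → (B.carrier ∩ U).Nonempty → ∀ᶠ a in l, ((A a).carrier ∩ U).Nonempty) := by
  rw [TopologicalSpace.tendsto_nhds_generateFrom_iff]
  constructor
  · intro h
    exact ⟨fun K hK hB => h _ (Or.inl ⟨K, hK, rfl⟩) hB,
      fun U hU hB => h _ (Or.inr ⟨U, hU, rfl⟩) hB⟩
  · rintro ⟨h₁, h₂⟩ S (⟨K, hK, rfl⟩ | ⟨U, hU, rfl⟩) hB
    · exact h₁ K hK hB
    · exact h₂ U hU hB

/-- If `x` lies in `A` but not in `B`, a compact neighbourhood `K` of `x` missing `B` separates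
them: `A` hits the interior of `K`, `B` misses `K`. -/
instance [LocallyCompactSpace X] : T2Space (ClosedSubset X) := by
  have key : ∀ A B : ClosedSubset X, ∀ x ∈ A.carrier, x ∉ B.carrier →
      ∃ u v : Set (ClosedSubset X), IsOpen u ∧ IsOpen v ∧ A ∈ u ∧ B ∈ v ∧ Disjoint u v := by
    intro A B x hA hB
    obtain ⟨K, hK, hxK, hKB⟩ := exists_compact_subset B.isClosed'.isOpen_compl hB
    refine ⟨_, _, isOpen_hit isOpen_interior, isOpen_miss hK, ⟨x, hA, hxK⟩,
      (Set.subset_compl_iff_disjoint_left.1 hKB), ?_⟩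
    rw [Set.disjoint_left]
    rintro C ⟨y, hy, hyK⟩ hC
    exact Set.disjoint_left.1 hC hy (interior_subset hyK)
  refine ⟨fun A B hAB => ?_⟩
  by_cases h : A.carrier ⊆ B.carrier
  · have h' : ¬ B.carrier ⊆ A.carrier := fun h' =>
      hAB (ClosedSubset.ext (Subset.antisymm h h'))
    obtain ⟨x, hB, hA⟩ := not_subset.1 h'
    obtain ⟨u, v, hu, hv, hBu, hAv, huv⟩ := key B A x hB hA
    exact ⟨v, u, hv, hu, hAv, hBu, huv.symm⟩
  · obtain ⟨x, hA, hB⟩ := not_subset.1 h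
    exact key A B x hA hB

theorem mem_of_tendsto [LocallyCompactSpace X] {α : Type*} {l : Filter α} [l.NeBot]
    {A : α → ClosedSubset X} {B : ClosedSubset X} {x : α → X} {y : X} (hA : Tendsto A l (𝓝 B))
    (hx : Tendsto x l (𝓝 y)) (h : ∀ᶠ a in l, x a ∈ (A a).carrier) : y ∈ B.carrier := by
  by_contra hy
  obtain ⟨K, hK, hyK, hKB⟩ := exists_compact_subset B.isClosed'.isOpen_compl hy
  have h₁ := (tendsto_iff.1 hA).1 K hK (Set.subset_compl_iff_disjoint_left.1 hKB)
  obtain ⟨a, ha₁, ha₂, ha₃⟩ :=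
    (h₁.and (h.and (hx.eventually_mem (mem_interior_iff_mem_nhds.1 hyK)))).exists
  exact Set.disjoint_left.1 ha₁ ha₂ ha₃

end Basic

section Cone

variable {X : Type*} [NormedAddCommGroup X] [InnerProductSpace ℝ X]

/-- The set of closed convex cones. -/
def cones (X : Type*) [NormedAddCommGroup X] [InnerProductSpace ℝ X] : Set (ClosedSubset X) :=
  {F | ∃ K : ProperCone ℝ X, (K : Set X) = F.carrier}

/-- The bipolar theorem, phrased for points of the Fell space. -/
theorem mem_carrier_iff_of_mem_cones [CompleteSpace X] {F : ClosedSubset X} (hF : F ∈ cones X)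
    {y : X} :
    y ∈ F.carrier ↔ ∀ w ∈ ProperCone.innerDual F.carrier, 0 ≤ ⟪w, y⟫ := by
  obtain ⟨K, hK⟩ := hF
  have h := ProperCone.innerDual_innerDual K
  rw [← hK]
  constructor
  · intro hy w hw
    rw [real_inner_comm]
    exact hw hy
  · intro hy
    have : y ∈ ProperCone.innerDual (ProperCone.innerDual (K : Set X) : Set X) := fun w hw => hy w hw
    rwa [h] at this

theorem zero_mem_of_mem_cones {F : ClosedSubset X} (hF : F ∈ cones X) : 0 ∈ F.carrier := by
  obtain ⟨K, hK⟩ := hF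
  rw [← hK]
  exact K.zero_mem

theorem smul_mem_of_mem_cones {F : ClosedSubset X} (hF : F ∈ cones X) {x : X}
    (hx : x ∈ F.carrier) {t : ℝ} (ht : 0 ≤ t) : t • x ∈ F.carrier := by
  obtain ⟨K, hK⟩ := hF
  rw [← hK] at hx ⊢
  exact K.smul_mem hx ht

theorem add_mem_of_mem_cones {F : ClosedSubset X} (hF : F ∈ cones X) {x y : X}
    (hx : x ∈ F.carrier) (hy : y ∈ F.carrier) : x + y ∈ F.carrier := by
  obtain ⟨K, hK⟩ := hF
  rw [← hK] at hx hy ⊢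
  exact K.add_mem hx hy

end Cone

end ClosedSubset

/-! ### Continuity of polarity and translated dual cones -/

namespace ProperCone

variable {X : Type*} [NormedAddCommGroup X] [InnerProductSpace ℝ X] [FiniteDimensional ℝ X]

theorem mem_innerDual_iff {s : Set X} {y : X} :
    y ∈ innerDual s ↔ ∀ x ∈ s, 0 ≤ ⟪x, y⟫ := Iff.rfl

/-- The metric projection onto a closed convex cone, in the form of Moreau's theorem. -/
theorem exists_sub_mem_innerDual (K : ProperCone ℝ X) (z : X) :
    ∃ p ∈ K, p - z ∈ innerDual (K : Set X) ∧ ⟪p - z, p⟫ = 0 := by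
  obtain ⟨p, hp, hmin⟩ := exists_norm_eq_iInf_of_complete_convex K.nonempty
    K.isClosed.isComplete K.convex z
  have h := (norm_eq_iInf_iff_real_inner_le_zero K.convex hp).1 hmin
  have hpp : ⟪z - p, p⟫ = 0 := by
    have h₁ := h 0 K.zero_mem
    have h₂ := h ((2 : ℝ) • p) (K.smul_mem hp zero_le_two)
    rw [zero_sub, inner_neg_right] at h₁
    rw [two_smul, add_sub_cancel_right] at h₂
    linarith
  refine ⟨p, hp, fun w hw => ?_, by rw [← neg_sub, inner_neg_left, hpp, neg_zero]⟩
  have h₁ := h w hw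
  rw [inner_sub_right, hpp, sub_zero] at h₁
  change 0 ≤ ⟪w, p - z⟫
  rw [real_inner_comm, ← neg_sub, inner_neg_left]
  linarith

/-- A point which is almost nonnegative on a cone is close to the dual cone. -/
theorem exists_mem_innerDual_norm_sub_lt {F : ClosedSubset X} (hF : F ∈ ClosedSubset.cones X)
    {z : X} {ε : ℝ} (hε : 0 < ε) (h : ∀ f ∈ F.carrier, ‖f‖ = 1 → -ε < ⟪f, z⟫) :
    ∃ p ∈ innerDual F.carrier, ‖p - z‖ < ε := by
  obtain ⟨p, hp, hpz, hpp⟩ := exists_sub_mem_innerDual (innerDual F.carrier) z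
  refine ⟨p, hp, ?_⟩
  -- The residual lies in the bipolar, hence in `F`. Normalised, it is a unit vector of `F` whose
  -- product with `z` is `-‖p - z‖`, so the hypothesis bounds the distance.
  have hf : p - z ∈ F.carrier := (ClosedSubset.mem_carrier_iff_of_mem_cones hF).2 hpz
  by_cases h0 : ‖p - z‖ = 0
  · rwa [h0]
  have hpos : 0 < ‖p - z‖ := lt_of_le_of_ne (norm_nonneg _) (Ne.symm h0)
  have h₁ := h (‖p - z‖⁻¹ • (p - z))
    (ClosedSubset.smul_mem_of_mem_cones hF hf (inv_nonneg.2 hpos.le))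
    (by rw [norm_smul, norm_inv, norm_norm, inv_mul_cancel₀ h0])
  have h₂ : ⟪p - z, z⟫ = -‖p - z‖ ^ 2 := by
    rw [← real_inner_self_eq_norm_sq, inner_sub_right (p - z), hpp]
    ring
  rw [inner_smul_left, h₂] at h₁
  simp only [map_inv₀, conj_trivial] at h₁
  have h₃ : ‖p - z‖⁻¹ * -‖p - z‖ ^ 2 = -‖p - z‖ := by
    field_simp
  rw [h₃] at h₁
  linarith

/-- The dual cone depends lower semicontinuously on the cone. -/
theorem eventually_exists_mem_innerDual {α : Type*} {l : Filter α} {F : α → ClosedSubset X}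
    {F₀ : ClosedSubset X} (hF : ∀ᶠ a in l, F a ∈ ClosedSubset.cones X)
    (h : Tendsto F l (𝓝 F₀)) {z : X} (hz : z ∈ innerDual F₀.carrier) {ε : ℝ} (hε : 0 < ε) :
    ∀ᶠ a in l, ∃ p ∈ innerDual (F a).carrier, ‖p - z‖ < ε := by
  have hK : IsCompact (Metric.sphere (0 : X) 1 ∩ {f | ⟪f, z⟫ ≤ -ε}) :=
    (isCompact_sphere 0 1).inter_right
      (isClosed_le (continuous_id.inner continuous_const) continuous_const)
  have hd : Disjoint F₀.carrier (Metric.sphere (0 : X) 1 ∩ {f | ⟪f, z⟫ ≤ -ε}) := by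
    rw [Set.disjoint_left]
    rintro f hf ⟨-, hfz⟩
    have h₁ : 0 ≤ ⟪f, z⟫ := hz hf
    have h₂ : ⟪f, z⟫ ≤ -ε := hfz
    linarith
  filter_upwards [hF, (ClosedSubset.tendsto_iff.1 h).1 _ hK hd] with a ha hda
  refine exists_mem_innerDual_norm_sub_lt ha hε fun f hf hf1 => ?_
  by_contra hlt
  exact Set.disjoint_left.1 hda hf ⟨by simpa using hf1, not_lt.1 hlt⟩

/-- Polarity is continuous on the space of closed convex cones. -/
theorem tendsto_subDual_zero {α : Type*} {l : Filter α} {F : α → ClosedSubset X}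
    {F₀ : ClosedSubset X} (hF : ∀ᶠ a in l, F a ∈ ClosedSubset.cones X)
    (h : Tendsto F l (𝓝 F₀)) :
    Tendsto (fun a => subDual 0 (F a).carrier) l (𝓝 (subDual 0 F₀.carrier)) := by
  refine ClosedSubset.tendsto_iff.2 ⟨fun K hK hd => ?_, fun U hU hne => ?_⟩
  -- A point outside `-F₀^*` is excluded by some `f ∈ F₀`. This exclusion is open in both variables
  -- and the nearby cones hit a neighbourhood of `f`; compactness of `K` makes it uniform.
  · have hloc : ∀ k ∈ K, ∃ t ∈ 𝓝[K] k, ∀ᶠ a in l, Disjoint (subDual 0 (F a).carrier).carrier t := by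
      intro k hk
      have hk' : ¬ (0 - k) ∈ innerDual F₀.carrier := fun h' => Set.disjoint_left.1 hd h' hk
      rw [mem_innerDual_iff] at hk'
      push Not at hk'
      obtain ⟨f, hf, hfk⟩ := hk'
      have hopen : IsOpen {q : X × X | ⟪q.1, 0 - q.2⟫ < 0} :=
        isOpen_lt (continuous_fst.inner (continuous_const.sub continuous_snd)) continuous_const
      obtain ⟨u, v, hu, hv, hfu, hkv, huv⟩ := isOpen_prod_iff.1 hopen f k hfk
      refine ⟨v, mem_nhdsWithin_of_mem_nhds (hv.mem_nhds hkv), ?_⟩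
      filter_upwards [(ClosedSubset.tendsto_iff.1 h).2 u hu ⟨f, hf, hfu⟩] with a ha
      obtain ⟨g, hg, hgu⟩ := ha
      rw [Set.disjoint_left]
      intro w hw hwv
      have h₁ : 0 ≤ ⟪g, 0 - w⟫ := hw hg
      have h₂ : ⟪g, 0 - w⟫ < 0 := huv (mk_mem_prod hgu hwv)
      linarith
    refine hK.induction_on (p := fun t => ∀ᶠ a in l, Disjoint (subDual 0 (F a).carrier).carrier t)
      ?_ ?_ ?_ hloc
    · simp
    · intro s t hst ht
      filter_upwards [ht] with a ha using ha.mono_right hst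
    · intro s t hs ht
      filter_upwards [hs, ht] with a ha hb using disjoint_union_right.2 ⟨ha, hb⟩
  · obtain ⟨y, hy, hyU⟩ := hne
    obtain ⟨ε, hε, hball⟩ := Metric.isOpen_iff.1 hU y hyU
    filter_upwards [eventually_exists_mem_innerDual hF h (z := 0 - y) hy hε] with a ha
    obtain ⟨p, hp, hpz⟩ := ha
    refine ⟨-p, ?_, hball ?_⟩
    · change 0 - -p ∈ innerDual (F a).carrier
      rwa [zero_sub, neg_neg]
    · rwa [Metric.mem_ball, dist_eq_norm, ← norm_neg, show -(-p - y) = p - (0 - y) by abel]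

theorem vadd_subDual (x y : X) (F : Set X) : x +ᵥ subDual y F = subDual (x + y) F := by
  ext z
  change y - (z - x) ∈ innerDual F ↔ x + y - z ∈ innerDual F
  rw [show y - (z - x) = x + y - z by abel]

theorem tendsto_subDual {α : Type*} {l : Filter α} {F : α → ClosedSubset X}
    {F₀ : ClosedSubset X} {x : α → X} {x₀ : X} (hF : ∀ᶠ a in l, F a ∈ ClosedSubset.cones X)
    (h : Tendsto F l (𝓝 F₀)) (hx : Tendsto x l (𝓝 x₀)) :
    Tendsto (fun a => subDual (x a) (F a).carrier) l (𝓝 (subDual x₀ F₀.carrier)) := by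
  have h₁ := hx.vadd (tendsto_subDual_zero hF h)
  simpa only [vadd_subDual, add_zero] using h₁

omit [FiniteDimensional ℝ X] in
theorem mem_orthogonal_span_iff {s : Set X} {y : X} :
    y ∈ (Submodule.span ℝ s)ᗮ ↔ ∀ x ∈ s, ⟪x, y⟫ = 0 := by
  constructor
  · intro h x hx
    exact h x (Submodule.subset_span hx)
  · intro h x hx
    induction hx using Submodule.span_induction with
    | mem x hx => exact h x hx
    | zero => exact inner_zero_left _
    | add x z _ _ hx hz => rw [inner_add_left, hx, hz, add_zero]
    | smul c x _ hx => rw [inner_smul_left, hx, mul_zero]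

theorem mem_innerDual_of_mem_orthogonal {s : Set X} {y : X} (h : y ∈ (Submodule.span ℝ s)ᗮ) :
    y ∈ innerDual s := fun _ hx => (mem_orthogonal_span_iff.1 h _ hx).ge

/-- Together with the preceding inclusion, this identifies `F^⊥` as the lineality space of `F^*`. -/
theorem mem_orthogonal_of_mem_innerDual {s : Set X} {y : X} (h : y ∈ innerDual s)
    (h' : -y ∈ innerDual s) : y ∈ (Submodule.span ℝ s)ᗮ := by
  refine mem_orthogonal_span_iff.2 fun x hx => le_antisymm ?_ (h hx)
  have h₁ : 0 ≤ ⟪x, -y⟫ := h' hx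
  rw [inner_neg_right] at h₁
  linarith

/-- A direction of recession of a translated dual cone belongs to the dual cone. -/
theorem mem_innerDual_of_forall_add_smul_mem {s : Set X} {u v : X}
    (h : ∀ t : ℝ, 0 ≤ t → u + t • v ∈ innerDual s) : v ∈ innerDual s := by
  rw [mem_innerDual_iff]
  intro x hx
  by_contra hlt
  rw [not_le] at hlt
  -- With this `t` the product with `x` is `⟪x, u⟫ - |⟪x, u⟫| - 1`, which is negative.
  have h₁ : 0 ≤ ⟪x, u + ((|⟪x, u⟫| + 1) / -⟪x, v⟫) • v⟫ :=
    h ((|⟪x, u⟫| + 1) / -⟪x, v⟫) (by have := neg_pos.2 hlt; positivity) hx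
  rw [inner_add_right, inner_smul_right, div_neg, neg_mul, div_mul_cancel₀ _ hlt.ne] at h₁
  linarith [le_abs_self ⟪x, u⟫]

/-- The recession directions of `x - s^*` are those of `-s^*`, whatever `x` is, and inclusions pass
to recession directions. -/
theorem innerDual_le_of_subDual_le {s s' : Set X} {x x' : X}
    (h : (subDual x s).carrier ⊆ (subDual x' s').carrier) : innerDual s ≤ innerDual s' := by
  intro w hw
  refine mem_innerDual_of_forall_add_smul_mem (u := x' - x) fun t ht => ?_
  have h₁ : x - t • w ∈ (subDual x s).carrier := by
    change x - (x - t • w) ∈ innerDual s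
    rw [sub_sub_cancel]
    exact (innerDual s).smul_mem hw ht
  have h₂ : x' - (x - t • w) ∈ innerDual s' := h h₁
  rwa [show x' - (x - t • w) = x' - x + t • w by abel] at h₂

theorem carrier_subset_of_innerDual_le {F F' : ClosedSubset X} (hF' : F' ∈ ClosedSubset.cones X)
    (h : innerDual F'.carrier ≤ innerDual F.carrier) : F.carrier ⊆ F'.carrier := by
  intro f hf
  refine (ClosedSubset.mem_carrier_iff_of_mem_cones hF').2 fun w hw => ?_
  rw [real_inner_comm]
  exact h hw hf

theorem eq_of_innerDual_eq {F F' : ClosedSubset X} (hF : F ∈ ClosedSubset.cones X)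
    (hF' : F' ∈ ClosedSubset.cones X) (h : innerDual F.carrier = innerDual F'.carrier) :
    F = F' :=
  ClosedSubset.ext (Subset.antisymm (carrier_subset_of_innerDual_le hF' h.ge)
    (carrier_subset_of_innerDual_le hF h.le))

/-- A translated dual cone determines the cone. -/
theorem eq_and_sub_mem_of_subDual_eq {F F' : ClosedSubset X} (hF : F ∈ ClosedSubset.cones X)
    (hF' : F' ∈ ClosedSubset.cones X) {x x' : X}
    (h : subDual x F.carrier = subDual x' F'.carrier) :
    F = F' ∧ x - x' ∈ (Submodule.span ℝ F.carrier)ᗮ := by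
  have hFF : F = F' := eq_of_innerDual_eq hF hF' (le_antisymm
    (innerDual_le_of_subDual_le (by rw [h])) (innerDual_le_of_subDual_le (by rw [h])))
  refine ⟨hFF, ?_⟩
  subst hFF
  have h₁ : x' ∈ (subDual x F.carrier).carrier := by
    rw [h]
    change x' - x' ∈ innerDual F.carrier
    rw [sub_self]
    exact (innerDual F.carrier).zero_mem
  have h₂ : x ∈ (subDual x' F.carrier).carrier := by
    rw [← h]
    change x - x ∈ innerDual F.carrier
    rw [sub_self]
    exact (innerDual F.carrier).zero_mem
  refine mem_orthogonal_of_mem_innerDual h₁ ?_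
  rw [neg_sub]
  exact h₂

theorem subDual_eq_of_sub_mem {F : Set X} {x x' : X}
    (h : x - x' ∈ (Submodule.span ℝ F)ᗮ) : subDual x F = subDual x' F := by
  have key : ∀ a b : X, a - b ∈ (Submodule.span ℝ F)ᗮ → ∀ z, b - z ∈ innerDual F →
      a - z ∈ innerDual F := by
    intro a b hab z hz
    rw [show a - z = (a - b) + (b - z) by abel]
    exact (innerDual F).add_mem (mem_innerDual_of_mem_orthogonal hab) hz
  ext z
  refine ⟨key x' x ?_ z, key x x' h z⟩
  rw [← neg_sub]
  exact Submodule.neg_mem _ h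

end ProperCone

/-! ### Faces of a closed convex cone and their place in the closure -/

section Faces

variable {X : Type*} [NormedAddCommGroup X] [InnerProductSpace ℝ X]

/-- A nonempty closed convex face of a set. -/
def IsConvexFace (K : Set X) (F : ClosedSubset X) : Prop :=
  F.carrier.Nonempty ∧ Convex ℝ F.carrier ∧ IsExtreme ℝ K F.carrier

namespace IsConvexFace

variable {K : ProperCone ℝ X} {F : ClosedSubset X}

/-- A face is not assumed to be a cone. It becomes one because `x` lies strictly between `t • x` and
`t⁻¹ • x`, or between `0` and `2 • x` when `t = 0`. -/
theorem smul_mem (hF : IsConvexFace (K : Set X) F) {x : X} (hx : x ∈ F.carrier) {t : ℝ}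
    (ht : 0 ≤ t) : t • x ∈ F.carrier := by
  have hxK := hF.2.2.subset hx
  rcases ht.eq_or_lt with rfl | ht
  · refine hF.2.2.left_mem_of_mem_openSegment (K.smul_mem hxK le_rfl)
      (K.smul_mem hxK zero_le_two) hx ⟨1 / 2, 1 / 2, by norm_num, by norm_num, by norm_num, ?_⟩
    module
  · refine hF.2.2.left_mem_of_mem_openSegment (K.smul_mem hxK ht.le)
      (K.smul_mem hxK (inv_nonneg.2 ht.le)) hx
      ⟨1 / (t + 1), t / (t + 1), by positivity, by positivity, by field_simp; ring, ?_⟩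
    rw [smul_smul, smul_smul, ← add_smul]
    convert one_smul ℝ x using 2
    field_simp

theorem add_mem (hF : IsConvexFace (K : Set X) F) {x y : X} (hx : x ∈ F.carrier)
    (hy : y ∈ F.carrier) : x + y ∈ F.carrier := by
  have h := hF.smul_mem (hF.2.1 hx hy (show (0 : ℝ) ≤ 1 / 2 by norm_num)
    (show (0 : ℝ) ≤ 1 / 2 by norm_num) (by norm_num)) zero_le_two
  convert h using 1
  module

theorem left_mem_of_add_mem (hF : IsConvexFace (K : Set X) F) {x y : X} (hx : x ∈ K)
    (hy : y ∈ K) (h : x + y ∈ F.carrier) : x ∈ F.carrier := by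
  refine hF.2.2.left_mem_of_mem_openSegment hx hy
    (hF.smul_mem h (t := 1 / 2) (by norm_num)) ⟨1 / 2, 1 / 2, by norm_num, by norm_num,
      by norm_num, ?_⟩
  module

theorem mem_cones (hF : IsConvexFace (K : Set X) F) : F ∈ ClosedSubset.cones X := by
  refine ⟨⟨⟨⟨⟨F.carrier, fun hx hy => hF.add_mem hx hy⟩, ?_⟩, ?_⟩, F.isClosed'⟩, rfl⟩
  · obtain ⟨x, hx⟩ := hF.1
    simpa using hF.smul_mem hx le_rfl
  · intro c x hx
    exact hF.smul_mem hx c.2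

end IsConvexFace

theorem ClosedSubset.exists_eq_sub_of_mem_span {F : ClosedSubset X} (hF : F ∈ cones X) {y : X}
    (hy : y ∈ Submodule.span ℝ F.carrier) : ∃ a ∈ F.carrier, ∃ b ∈ F.carrier, y = a - b := by
  have h0 := zero_mem_of_mem_cones hF
  induction hy using Submodule.span_induction with
  | mem x hx => exact ⟨x, hx, 0, h0, (sub_zero x).symm⟩
  | zero => exact ⟨0, h0, 0, h0, (sub_zero 0).symm⟩
  | add x y _ _ hx hy =>
    obtain ⟨a, ha, b, hb, rfl⟩ := hx
    obtain ⟨c, hc, d, hd, rfl⟩ := hy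
    exact ⟨a + c, add_mem_of_mem_cones hF ha hc, b + d, add_mem_of_mem_cones hF hb hd, by abel⟩
  | smul t x _ hx =>
    obtain ⟨a, ha, b, hb, rfl⟩ := hx
    rcases le_total 0 t with ht | ht
    · exact ⟨_, smul_mem_of_mem_cones hF ha ht, _, smul_mem_of_mem_cones hF hb ht, smul_sub _ _ _⟩
    · refine ⟨_, smul_mem_of_mem_cones hF hb (neg_nonneg.2 ht), _,
        smul_mem_of_mem_cones hF ha (neg_nonneg.2 ht), ?_⟩
      module

/-- The affine span is closed, hence everything, so the set has interior points; a convex set with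
interior points has the same interior as its closure. -/
theorem Convex.eq_univ_of_dense [FiniteDimensional ℝ X] {s : Set X} (hs : Convex ℝ s)
    (hd : Dense s) : s = univ := by
  have haff : affineSpan ℝ s = ⊤ := by
    have hcl : IsClosed (affineSpan ℝ s : Set X) := AffineSubspace.closed_of_finiteDimensional _
    have h := (hd.mono (subset_affineSpan ℝ s)).closure_eq
    rw [hcl.closure_eq] at h
    exact SetLike.coe_injective (by simpa using h)
  have h := hs.interior_closure_eq_interior_of_nonempty_interior
    (hs.interior_nonempty_iff_affineSpan_eq_top.2 haff)
  rw [hd.closure_eq, interior_univ] at h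
  exact univ_subset_iff.1 (h.trans_subset interior_subset)

variable [FiniteDimensional ℝ X]

/-- A proper face of a closed convex cone is contained in a proper exposed face. -/
theorem IsConvexFace.exists_ne_zero_mem_innerDual {K : ProperCone ℝ X} {F : ClosedSubset X}
    (hF : IsConvexFace (K : Set X) F) (hne : F.carrier ≠ K) :
    ∃ w ∈ ProperCone.innerDual (K : Set X), w ∈ Submodule.span ℝ (K : Set X) ∧ w ≠ 0 ∧
      ∀ f ∈ F.carrier, ⟪f, w⟫ = 0 := by
  by_contra hcon
  push Not at hcon
  -- The vectors sought are the nonzero elements of the dual of `D = K + span F + (span K)^⊥`. If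
  -- there are none, `D` is dense, hence everything. Writing `-c = c' + (a - b)` for `c ∈ K`, with
  -- `a, b ∈ F`, gives `c + (c' + a) = b ∈ F`, so `c ∈ F` and `F = K`.
  let D : PointedCone ℝ X := (K : PointedCone ℝ X) ⊔
    ((Submodule.span ℝ F.carrier).restrictScalars ℝ≥0 ⊔
      ((Submodule.span ℝ (K : Set X))ᗮ).restrictScalars ℝ≥0)
  let C : ProperCone ℝ X := Submodule.closure D
  have hDC : ∀ x ∈ D, x ∈ C := fun x hx => subset_closure hx
  have hdual : ∀ w ∈ ProperCone.innerDual (C : Set X), w = 0 := by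
    intro w hw
    have hwK : w ∈ ProperCone.innerDual (K : Set X) := fun x hx =>
      hw (hDC x (Submodule.mem_sup_left hx))
    have hwp : ∀ y ∈ Submodule.span ℝ F.carrier ⊔ (Submodule.span ℝ (K : Set X))ᗮ,
        ⟪y, w⟫ = 0 := by
      have h₁ : ∀ y ∈ Submodule.span ℝ F.carrier ⊔ (Submodule.span ℝ (K : Set X))ᗮ,
          0 ≤ ⟪y, w⟫ := by
        intro y hy
        obtain ⟨a, ha, b, hb, rfl⟩ := Submodule.mem_sup.1 hy
        exact hw (hDC _ (Submodule.mem_sup_right (Submodule.add_mem_sup ha hb)))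
      intro y hy
      have h₂ := h₁ (-y) (Submodule.neg_mem _ hy)
      rw [inner_neg_left] at h₂
      linarith [h₁ y hy]
    by_contra hw0
    obtain ⟨f, hf, hfw⟩ := hcon w hwK (by
      rw [← Submodule.orthogonal_orthogonal (Submodule.span ℝ (K : Set X))]
      exact fun y hy => hwp y (Submodule.mem_sup_right hy)) hw0
    exact hfw (hwp f (Submodule.mem_sup_left (Submodule.subset_span hf)))
  have hCtop : ∀ x, x ∈ C := by
    intro x
    rw [← ProperCone.innerDual_innerDual C]
    intro w hw
    rw [hdual w hw]
    simp
  have hDuniv : (D : Set X) = univ :=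
    Convex.eq_univ_of_dense (PointedCone.convex D) fun x => hCtop x
  refine hne (Subset.antisymm hF.2.2.subset fun c hc => ?_)
  have hc' : -c ∈ D := by
    rw [← SetLike.mem_coe, hDuniv]
    trivial
  obtain ⟨c', hc', q, hq, hsum⟩ := Submodule.mem_sup.1 hc'
  obtain ⟨g, hg, p, hp, rfl⟩ := Submodule.mem_sup.1 hq
  have hFK : Submodule.span ℝ F.carrier ≤ Submodule.span ℝ (K : Set X) :=
    Submodule.span_mono hF.2.2.subset
  have hp0 : p = 0 := by
    have hpK : p ∈ Submodule.span ℝ (K : Set X) := by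
      rw [show p = -c - c' - g by rw [← hsum]; abel]
      exact Submodule.sub_mem _ (Submodule.sub_mem _
        (Submodule.neg_mem _ (Submodule.subset_span hc)) (Submodule.subset_span hc')) (hFK hg)
    exact inner_self_eq_zero.1 (hp p hpK)
  obtain ⟨a, ha, b, hb, rfl⟩ := ClosedSubset.exists_eq_sub_of_mem_span hF.mem_cones hg
  refine hF.left_mem_of_add_mem hc (K.add_mem hc' (hF.2.2.subset ha)) ?_
  convert hb using 1
  rw [hp0] at hsum
  have : c = -(c' + (a - b + 0)) := by rw [hsum, neg_neg]
  rw [this]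
  abel

/-- Faces of a closed convex cone which have the same linear span and are nested are equal. -/
theorem IsConvexFace.eq_of_subset {K : ProperCone ℝ X} {F F' : ClosedSubset X}
    (hF : IsConvexFace (K : Set X) F) (hF' : IsConvexFace (K : Set X) F')
    (h : F.carrier ⊆ F'.carrier) (hdim : spanDim F.carrier = spanDim F'.carrier) : F = F' := by
  have hspan := Submodule.eq_of_le_of_finrank_eq (Submodule.span_mono (R := ℝ) h) hdim
  refine ClosedSubset.ext (Subset.antisymm h fun f hf => ?_)
  have hf' : -f ∈ Submodule.span ℝ F.carrier := by
    rw [hspan]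
    exact Submodule.neg_mem _ (Submodule.subset_span hf)
  obtain ⟨a, ha, b, hb, hab⟩ := ClosedSubset.exists_eq_sub_of_mem_span hF.mem_cones hf'
  refine hF.left_mem_of_add_mem (hF'.2.2.subset hf) (hF.2.2.subset ha) ?_
  rwa [show f + a = b by rw [← neg_neg f, hab]; abel]

/-- If `w` lies in the dual of a cone, then the translates of the dual along `w` converge to the
dual of the face exposed by `w`. -/
theorem tendsto_subDual_add_smul {K K' : ProperCone ℝ X} {w : X}
    (hw : w ∈ ProperCone.innerDual (K : Set X)) (hK' : ∀ y ∈ K', ⟪y, w⟫ = 0)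
    (hdual : (ProperCone.innerDual (K' : Set X) : Set X) ⊆
      closure {x | ∃ v ∈ ProperCone.innerDual (K : Set X), ∃ t : ℝ, x = v + t • w})
    (hKK' : K' ≤ K) (y : X) :
    Tendsto (fun s : ℝ => subDual (y + s • w) (K : Set X)) atTop
      (𝓝 (subDual y (K' : Set X))) := by
  -- Every translate is contained in the limit, so compact sets missed by the limit are missed
  -- throughout. Conversely `v + t • w` becomes usable once `s + t ≥ 0`.
  refine ClosedSubset.tendsto_iff.2 ⟨fun B _ hd => Eventually.of_forall fun s =>
    hd.mono_left fun z hz => ?_, fun U hU hne => ?_⟩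
  · intro x hx
    have h₁ : 0 ≤ ⟪x, y + s • w - z⟫ := hz (hKK' hx)
    rw [add_sub_right_comm, inner_add_right, inner_smul_right, hK' x hx, mul_zero, add_zero] at h₁
    exact h₁
  · obtain ⟨z, hz, hzU⟩ := hne
    obtain ⟨x, hxU, v, hv, t, hx⟩ := mem_closure_iff.1 (hdual hz) {x | y - x ∈ U}
      (hU.preimage (continuous_const.sub continuous_id)) (by simpa using hzU)
    filter_upwards [eventually_ge_atTop (-t)] with s hs
    refine ⟨y - x, ?_, hxU⟩
    change y + s • w - (y - x) ∈ ProperCone.innerDual (K : Set X)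
    rw [show y + s • w - (y - x) = v + (t + s) • w by rw [hx]; module]
    exact (ProperCone.innerDual (K : Set X)).add_mem hv
      ((ProperCone.innerDual (K : Set X)).smul_mem hw (by linarith))

/-- The face of `K` exposed by an element of the dual of `K`, together with its dual cone. -/
theorem ProperCone.exists_exposed (K : ProperCone ℝ X) (w : X) :
    ∃ K' : ProperCone ℝ X, (∀ y, y ∈ K' ↔ y ∈ K ∧ ⟪y, w⟫ = 0) ∧
      (ProperCone.innerDual (K' : Set X) : Set X) =
        closure {x | ∃ v ∈ ProperCone.innerDual (K : Set X), ∃ t : ℝ, x = v + t • w} := by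
  -- The cone `K^* + ℝ w`: its dual is `K ∩ w^⊥`, so by biduality its closure is the dual of the
  -- exposed face.
  let D : PointedCone ℝ X := (ProperCone.innerDual (K : Set X) : PointedCone ℝ X) ⊔
    (Submodule.span ℝ {w}).restrictScalars ℝ≥0
  let C : ProperCone ℝ X := Submodule.closure D
  have hD : (D : Set X) =
      {x | ∃ v ∈ ProperCone.innerDual (K : Set X), ∃ t : ℝ, x = v + t • w} := by
    ext x
    constructor
    · intro hx
      obtain ⟨v, hv, q, hq, rfl⟩ := Submodule.mem_sup.1 hx
      obtain ⟨t, rfl⟩ := Submodule.mem_span_singleton.1 hq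
      exact ⟨v, hv, t, rfl⟩
    · rintro ⟨v, hv, t, rfl⟩
      exact Submodule.add_mem_sup hv (Submodule.mem_span_singleton.2 ⟨t, rfl⟩)
  refine ⟨ProperCone.innerDual (C : Set X), fun y => ⟨fun hy => ?_, fun hy => ?_⟩, ?_⟩
  · have h₁ : ∀ v ∈ ProperCone.innerDual (K : Set X), ∀ t : ℝ, 0 ≤ ⟪v + t • w, y⟫ := by
      intro v hv t
      refine hy (subset_closure ?_)
      change _ ∈ (D : Set X)
      rw [hD]
      exact ⟨v, hv, t, rfl⟩
    constructor
    · rw [← ProperCone.innerDual_innerDual K]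
      intro v hv
      simpa using h₁ v hv 0
    · have h₂ := h₁ 0 (ProperCone.innerDual (K : Set X)).zero_mem 1
      have h₃ := h₁ 0 (ProperCone.innerDual (K : Set X)).zero_mem (-1)
      rw [zero_add, one_smul] at h₂
      rw [zero_add, neg_one_smul, inner_neg_left] at h₃
      rw [real_inner_comm]
      linarith
  · intro x hx
    have hx' : x ∈ closure (D : Set X) := hx
    have hcl : IsClosed {x : X | 0 ≤ ⟪x, y⟫} :=
      isClosed_le continuous_const (continuous_id.inner continuous_const)
    refine closure_minimal ?_ hcl hx'
    rw [hD]
    rintro _ ⟨v, hv, t, rfl⟩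
    change 0 ≤ ⟪v + t • w, y⟫
    rw [inner_add_left, inner_smul_left, real_inner_comm y w, hy.2, mul_zero, add_zero,
      real_inner_comm]
    exact hv hy.1
  · rw [ProperCone.innerDual_innerDual, ← hD]
    rfl

/-- A closed set of closed sets which contains all `x - K^*`, `x ∈ K^*`, contains all `x - F^*`,
`x ∈ F^*`, for the faces `F` of `K`. -/
theorem IsConvexFace.subDual_mem_of_isClosed {S : Set (ClosedSubset X)} (hS : IsClosed S)
    {F : ClosedSubset X} {K : ProperCone ℝ X}
    (hK : ∀ x ∈ ProperCone.innerDual (K : Set X), subDual x (K : Set X) ∈ S)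
    (hF : IsConvexFace (K : Set X) F) :
    ∀ x ∈ ProperCone.innerDual F.carrier, subDual x F.carrier ∈ S := by
  -- Induction on the dimension of the ambient cone, with `F` fixed and `K` replaced by a proper
  -- exposed face containing `F`. The dimension drops since `w` is a nonzero vector of `span K`
  -- orthogonal to `K'`.
  induction hn : spanDim (K : Set X) using Nat.strong_induction_on generalizing K with
  | _ n ih =>
    by_cases hne : F.carrier = K
    · rwa [hne]
    obtain ⟨w, hwK, hwspan, hw0, hwF⟩ := hF.exists_ne_zero_mem_innerDual hne
    obtain ⟨K', hK', hdual⟩ := K.exists_exposed w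
    have hle : K' ≤ K := fun y hy => ((hK' y).1 hy).1
    refine ih (spanDim (K' : Set X)) ?_ (K := K') ?_ ?_ rfl
    · rw [← hn]
      refine Submodule.finrank_lt_finrank_of_lt (lt_of_le_of_ne (Submodule.span_mono hle) ?_)
      intro heq
      rw [← heq] at hwspan
      have hperp : w ∈ (Submodule.span ℝ (K' : Set X))ᗮ :=
        ProperCone.mem_orthogonal_span_iff.2 fun y hy => ((hK' y).1 hy).2
      exact hw0 (inner_self_eq_zero.1 (hperp w hwspan))
    · intro x hx
      have hcont : Continuous fun x => subDual x (K' : Set X) := by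
        have h : Continuous fun x : X => x +ᵥ subDual 0 (K' : Set X) :=
          continuous_id.vadd continuous_const
        simpa only [ProperCone.vadd_subDual, add_zero] using h
      -- By continuity in `x` it suffices to treat `v + t • w`, and `t • w ∈ K'^⊥` does not affect
      -- the translate.
      have hx' : x ∈ closure {x | ∃ v ∈ ProperCone.innerDual (K : Set X), ∃ t : ℝ,
          x = v + t • w} := by
        rw [← hdual]
        exact hx
      refine closure_minimal ?_ (hS.preimage hcont) hx'
      rintro _ ⟨v, hv, t, rfl⟩
      have hlim := tendsto_subDual_add_smul hwK (fun y hy => ((hK' y).1 hy).2) hdual.subset hle v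
      have hv' : subDual v (K' : Set X) ∈ S := by
        refine hS.mem_of_tendsto hlim ?_
        filter_upwards [eventually_ge_atTop 0] with s hs
        exact hK _ ((ProperCone.innerDual (K : Set X)).add_mem hv
          ((ProperCone.innerDual (K : Set X)).smul_mem hwK hs))
      change subDual (v + t • w) (K' : Set X) ∈ S
      rwa [ProperCone.subDual_eq_of_sub_mem (x' := v)]
      rw [add_sub_cancel_left]
      exact Submodule.smul_mem _ _
        (ProperCone.mem_orthogonal_span_iff.2 fun y hy => ((hK' y).1 hy).2)
    · exact ⟨hF.1, hF.2.1, hF.2.2.mono hle fun f hf =>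
        (hK' f).2 ⟨hF.2.2.subset hf, hwF f hf⟩⟩

end Faces

/-! ### Compact families of faces of constant dimension -/

section Strata

theorem ClosedSubset.subset_of_tendsto {X α : Type*} [TopologicalSpace X] [LocallyCompactSpace X]
    {l : Filter α} [l.NeBot] {A B : α → ClosedSubset X} {A₀ B₀ : ClosedSubset X}
    (hA : Tendsto A l (𝓝 A₀)) (hB : Tendsto B l (𝓝 B₀))
    (h : ∀ᶠ a in l, (A a).carrier ⊆ (B a).carrier) : A₀.carrier ⊆ B₀.carrier := by
  intro x hx
  by_contra hxB
  obtain ⟨K, hK, hxK, hKB⟩ := exists_compact_subset B₀.isClosed'.isOpen_compl hxB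
  have h₁ := (tendsto_iff.1 hB).1 K hK (Set.subset_compl_iff_disjoint_left.1 hKB)
  have h₂ := (tendsto_iff.1 hA).2 _ isOpen_interior ⟨x, hx, hxK⟩
  obtain ⟨a, ha₁, ⟨y, hyA, hyK⟩, ha₃⟩ := (h₁.and (h₂.and h)).exists
  exact Set.disjoint_left.1 ha₁ (ha₃ hyA) (interior_subset hyK)

variable {X : Type*} [NormedAddCommGroup X] [InnerProductSpace ℝ X] [FiniteDimensional ℝ X]

/-- Linear independence is an open condition. If `x₀` were outside `span F₀`, adjoining it to a
basis taken from `F₀` and perturbing would give too many independent vectors in the span of a nearby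
cone of the same dimension. -/
theorem mem_span_of_tendsto {α : Type*} {l : Filter α} [l.NeBot] {F : α → ClosedSubset X}
    {F₀ : ClosedSubset X} {x : α → X} {x₀ : X} (hF : Tendsto F l (𝓝 F₀))
    (hx : Tendsto x l (𝓝 x₀)) (hdim : ∀ᶠ a in l, spanDim (F a).carrier = spanDim F₀.carrier)
    (h : ∀ᶠ a in l, x a ∈ Submodule.span ℝ (F a).carrier) :
    x₀ ∈ Submodule.span ℝ F₀.carrier := by
  by_contra hx₀
  obtain ⟨b, hb, hspan, hli⟩ := Submodule.exists_fun_fin_finrank_span_eq ℝ F₀.carrier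
  have hli' : LinearIndependent ℝ (Fin.cons x₀ b : Fin (_ + 1) → X) :=
    linearIndependent_finCons.2 ⟨hli, by rwa [hspan]⟩
  obtain ⟨ε, hε, hball⟩ := Metric.isOpen_iff.1
    (isOpen_setOfPred_linearIndependent (𝕜 := ℝ) (E := X)) (Fin.cons x₀ b) hli'
  have h₁ : ∀ᶠ a in l, ∀ i, ((F a).carrier ∩ Metric.ball (b i) ε).Nonempty :=
    eventually_all.2 fun i => (ClosedSubset.tendsto_iff.1 hF).2 _ Metric.isOpen_ball
      ⟨b i, hb i, Metric.mem_ball_self hε⟩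
  obtain ⟨a, ha, hxa, hda, hsa⟩ :=
    (h₁.and ((hx.eventually_mem (Metric.ball_mem_nhds x₀ hε)).and (hdim.and h))).exists
  choose y hy using ha
  have hli'' : LinearIndependent ℝ (Fin.cons (x a) y : Fin (_ + 1) → X) := by
    refine hball ?_
    rw [Metric.mem_ball, dist_pi_lt_iff hε]
    intro i
    refine Fin.cases ?_ (fun i => ?_) i
    · exact hxa
    · exact (hy i).2
  have hle : Submodule.span ℝ (range (Fin.cons (x a) y : Fin (_ + 1) → X)) ≤
      Submodule.span ℝ (F a).carrier := by
    rw [Submodule.span_le]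
    rintro _ ⟨i, rfl⟩
    refine Fin.cases ?_ (fun i => ?_) i
    · exact hsa
    · exact Submodule.subset_span (hy i).1
  have hcard := Submodule.finrank_mono hle
  rw [finrank_span_eq_card hli'', Fintype.card_fin] at hcard
  have : spanDim F₀.carrier + 1 ≤ spanDim (F a).carrier := hcard
  omega

theorem mem_innerDual_of_tendsto {α : Type*} {l : Filter α} [l.NeBot] {F : α → ClosedSubset X}
    {F₀ : ClosedSubset X} {x : α → X} {x₀ : X} (hc : ∀ᶠ a in l, F a ∈ ClosedSubset.cones X)
    (hF : Tendsto F l (𝓝 F₀)) (hx : Tendsto x l (𝓝 x₀))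
    (h : ∀ᶠ a in l, x a ∈ ProperCone.innerDual (F a).carrier) :
    x₀ ∈ ProperCone.innerDual F₀.carrier := by
  have h₁ : -x₀ ∈ (subDual 0 F₀.carrier).carrier := by
    refine ClosedSubset.mem_of_tendsto (ProperCone.tendsto_subDual_zero hc hF) hx.neg ?_
    filter_upwards [h] with a ha
    change 0 - -x a ∈ ProperCone.innerDual (F a).carrier
    rwa [zero_sub, neg_neg]
  have h₂ : 0 - -x₀ ∈ ProperCone.innerDual F₀.carrier := h₁
  rwa [zero_sub, neg_neg] at h₂

/-- The orthogonal projections onto the spans of cones of a fixed dimension depend continuously on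
the cone. -/
theorem tendsto_starProjection_span {α : Type*} {l : Filter α} {F : α → ClosedSubset X}
    {F₀ : ClosedSubset X} (hc : ∀ᶠ a in l, F a ∈ ClosedSubset.cones X)
    (hF : Tendsto F l (𝓝 F₀)) (hdim : ∀ᶠ a in l, spanDim (F a).carrier = spanDim F₀.carrier)
    (u : X) :
    Tendsto (fun a => (Submodule.span ℝ (F a).carrier).starProjection u) l
      (𝓝 ((Submodule.span ℝ F₀.carrier).starProjection u)) := by
  -- The projections are bounded by `‖u‖`, so they converge along each ultrafilter. The limit lies
  -- in `span F₀` and its residual in `F₀^⊥`, which characterises the projection.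
  rw [tendsto_iff_ultrafilter]
  intro 𝒰 h𝒰
  obtain ⟨p, -, hp⟩ := (isCompact_closedBall (0 : X) ‖u‖).ultrafilter_le_nhds
    (𝒰.map fun a => (Submodule.span ℝ (F a).carrier).starProjection u)
    (le_principal_iff.2 (Ultrafilter.mem_map.2 (univ_mem' fun a => by
      simpa using Submodule.norm_starProjection_apply_le _ u)))
  have hp' : Tendsto (fun a => (Submodule.span ℝ (F a).carrier).starProjection u) 𝒰 (𝓝 p) := hp
  have hF' := hF.mono_left h𝒰
  have hc' := hc.filter_mono h𝒰
  have hsub := (tendsto_const_nhds (x := u)).sub hp'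
  have hpF : p ∈ Submodule.span ℝ F₀.carrier :=
    mem_span_of_tendsto hF' hp' (hdim.filter_mono h𝒰)
      (Eventually.of_forall fun a => Submodule.starProjection_apply_mem _ _)
  have hperp : u - p ∈ (Submodule.span ℝ F₀.carrier)ᗮ := by
    refine ProperCone.mem_orthogonal_of_mem_innerDual
      (mem_innerDual_of_tendsto hc' hF' hsub (Eventually.of_forall fun a =>
        ProperCone.mem_innerDual_of_mem_orthogonal (Submodule.sub_starProjection_mem_orthogonal _)))
      (mem_innerDual_of_tendsto hc' hF' hsub.neg (Eventually.of_forall fun a =>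
        ProperCone.mem_innerDual_of_mem_orthogonal (Submodule.neg_mem _
          (Submodule.sub_starProjection_mem_orthogonal _))))
  rwa [Submodule.eq_starProjection_of_mem_orthogonal hpF hperp]

/-- A point of a dual cone extends to a section of dual cones which is continuous at the given
cone. -/
theorem exists_tendsto_mem_innerDual {F₀ : ClosedSubset X} {z : X}
    (hz : z ∈ ProperCone.innerDual F₀.carrier) :
    ∃ q : ClosedSubset X → X, (∀ F, q F ∈ ProperCone.innerDual F.carrier) ∧ q F₀ = z ∧
      Tendsto q (𝓝[ClosedSubset.cones X] F₀) (𝓝 z) := by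
  -- The section takes the point of `F^*` nearest to `z`.
  choose q hq hmin using fun F : ClosedSubset X =>
    exists_norm_eq_iInf_of_complete_convex (ProperCone.innerDual F.carrier).nonempty
      (ProperCone.innerDual F.carrier).isClosed.isComplete
      (ProperCone.innerDual F.carrier).convex z
  have hle : ∀ F, ∀ p ∈ ProperCone.innerDual F.carrier, ‖z - q F‖ ≤ ‖z - p‖ := by
    intro F p hp
    rw [hmin F]
    exact ciInf_le ⟨0, by rintro _ ⟨w, rfl⟩; exact norm_nonneg _⟩
      (⟨p, hp⟩ : (ProperCone.innerDual F.carrier : Set X))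
  refine ⟨q, hq, ?_, ?_⟩
  · have h := hle F₀ z hz
    rw [sub_self, norm_zero] at h
    exact (sub_eq_zero.1 (norm_le_zero_iff.1 h)).symm
  · refine Metric.tendsto_nhds.2 fun ε hε => ?_
    filter_upwards [ProperCone.eventually_exists_mem_innerDual
      (F := fun F : ClosedSubset X => F) eventually_mem_nhdsWithin
      (tendsto_id.mono_left nhdsWithin_le_nhds) hz hε] with F hF
    obtain ⟨p, hp, hpz⟩ := hF
    rw [dist_eq_norm, norm_sub_rev]
    rw [norm_sub_rev] at hpz
    exact (hle F p hp).trans_lt hpz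

/-- A compact set of faces of the same dimension of a closed convex cone. -/
structure IsFaceStratum (K : ProperCone ℝ X) (S : Set (ClosedSubset X)) : Prop where
  isCompact : IsCompact S
  isConvexFace : ∀ F ∈ S, IsConvexFace (K : Set X) F
  spanDim_eq : ∀ F ∈ S, ∀ F' ∈ S, spanDim F.carrier = spanDim F'.carrier

namespace IsFaceStratum

variable {K : ProperCone ℝ X} {S : Set (ClosedSubset X)}

omit [FiniteDimensional ℝ X] in
theorem mem_cones (hS : IsFaceStratum K S) {F : ClosedSubset X} (hF : F ∈ S) :
    F ∈ ClosedSubset.cones X := (hS.isConvexFace F hF).mem_cones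

/-- The points `x - F^*` depend properly on the face `F` and the point `x ∈ F^⊛`. -/
theorem tendsto_of_tendsto_subDual (hS : IsFaceStratum K S) {α : Type*} (𝒰 : Ultrafilter α)
    {F : α → ClosedSubset X} {x : α → X} {F₀ : ClosedSubset X} {x₀ : X} (hF : ∀ a, F a ∈ S)
    (hx : ∀ a, x a ∈ relDual (F a).carrier) (hF₀ : F₀ ∈ S) (hx₀ : x₀ ∈ relDual F₀.carrier)
    (h : Tendsto (fun a => subDual (x a) (F a).carrier) 𝒰 (𝓝 (subDual x₀ F₀.carrier))) :
    Tendsto F 𝒰 (𝓝 F₀) ∧ Tendsto x 𝒰 (𝓝 x₀) := by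
  obtain ⟨F', hF'S, hF'⟩ := hS.isCompact.ultrafilter_le_nhds (𝒰.map F)
    (le_principal_iff.2 (Ultrafilter.mem_map.2 (univ_mem' hF)))
  replace hF' : Tendsto F 𝒰 (𝓝 F') := hF'
  have hc : ∀ᶠ a in (𝒰 : Filter α), F a ∈ ClosedSubset.cones X :=
    Eventually.of_forall fun a => hS.mem_cones (hF a)
  have hdim : ∀ᶠ a in (𝒰 : Filter α), spanDim (F a).carrier = spanDim F'.carrier :=
    Eventually.of_forall fun a => hS.spanDim_eq _ (hF a) _ hF'S
  by_cases hb : ∃ R, ∀ᶠ a in (𝒰 : Filter α), ‖x a‖ ≤ R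
  · obtain ⟨R, hR⟩ := hb
    obtain ⟨x', -, hx'⟩ := (isCompact_closedBall (0 : X) R).ultrafilter_le_nhds (𝒰.map x)
      (le_principal_iff.2 (Ultrafilter.mem_map.2 (by
        filter_upwards [hR] with a ha
        simpa using ha)))
    replace hx' : Tendsto x 𝒰 (𝓝 x') := hx'
    have heq := tendsto_nhds_unique (ProperCone.tendsto_subDual hc hF' hx') h
    obtain ⟨rfl, hperp⟩ := ProperCone.eq_and_sub_mem_of_subDual_eq (hS.mem_cones hF'S)
      (hS.mem_cones hF₀) heq
    have hspan : x' - x₀ ∈ Submodule.span ℝ F'.carrier := Submodule.sub_mem _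
      (mem_span_of_tendsto hF' hx' hdim (Eventually.of_forall fun a => (hx a).1)) hx₀.1
    rw [sub_eq_zero.1 (inner_self_eq_zero.1 (hperp _ hspan))] at hx'
    exact ⟨hF', hx'⟩
  · exfalso
    -- If `x` is unbounded, let `v` be the limit of the normalised vectors. As `s • x / ‖x‖ - F^*`
    -- lies in `x - F^*` once `‖x‖ > s`, the limit `x₀ - F₀^*` contains `s • v - F'^*` for all `s ≥
    -- 0`.
    push Not at hb
    obtain ⟨v, hv1, hv⟩ := (isCompact_sphere (0 : X) 1).ultrafilter_le_nhds
      (𝒰.map fun a => ‖x a‖⁻¹ • x a)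
      (le_principal_iff.2 (Ultrafilter.mem_map.2 (by
        filter_upwards [hb 0] with a ha
        simp [norm_smul, ha.ne'])))
    replace hv : Tendsto (fun a => ‖x a‖⁻¹ • x a) 𝒰 (𝓝 v) := hv
    have hvspan : v ∈ Submodule.span ℝ F'.carrier := mem_span_of_tendsto hF' hv hdim
      (Eventually.of_forall fun a => Submodule.smul_mem _ _ (hx a).1)
    have hvdual : v ∈ ProperCone.innerDual F'.carrier := mem_innerDual_of_tendsto hc hF' hv
      (Eventually.of_forall fun a => (ProperCone.innerDual (F a).carrier).smul_mem (hx a).2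
        (inv_nonneg.2 (norm_nonneg _)))
    have hsub : ∀ s : ℝ, 0 ≤ s →
        (subDual (s • v) F'.carrier).carrier ⊆ (subDual x₀ F₀.carrier).carrier := by
      intro s hs
      refine ClosedSubset.subset_of_tendsto
        (ProperCone.tendsto_subDual hc hF' (hv.const_smul s)) h ?_
      filter_upwards [hb s, hb 0] with a ha ha0 z hz
      have h₁ : s • ‖x a‖⁻¹ • x a - z ∈ ProperCone.innerDual (F a).carrier := hz
      have h₂ : (1 - s * ‖x a‖⁻¹) • x a ∈ ProperCone.innerDual (F a).carrier := by
        refine (ProperCone.innerDual (F a).carrier).smul_mem (hx a).2 (sub_nonneg.2 ?_)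
        rw [← div_eq_mul_inv]
        exact (div_le_one ha0).2 ha.le
      have h₃ := (ProperCone.innerDual (F a).carrier).add_mem h₂ h₁
      change x a - z ∈ ProperCone.innerDual (F a).carrier
      rwa [show (1 - s * ‖x a‖⁻¹) • x a + (s • ‖x a‖⁻¹ • x a - z) = x a - z by module] at h₃
    -- The case `s = 0` gives `F₀ ⊆ F'`, and equal dimension gives equality. The whole ray then puts
    -- `-v` in `F₀^*`, so `v` is in both `F₀^⊥` and `span F₀`, contradicting `‖v‖ = 1`.
    have hFF : F₀ = F' := (hS.isConvexFace _ hF₀).eq_of_subset (hS.isConvexFace _ hF'S)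
      (ProperCone.carrier_subset_of_innerDual_le (hS.mem_cones hF'S)
        (ProperCone.innerDual_le_of_subDual_le (hsub 0 le_rfl))) (hS.spanDim_eq _ hF₀ _ hF'S)
    subst hFF
    have hvneg : -v ∈ ProperCone.innerDual F₀.carrier := by
      refine ProperCone.mem_innerDual_of_forall_add_smul_mem (u := x₀) fun t ht => ?_
      have h₁ : x₀ - t • v ∈ ProperCone.innerDual F₀.carrier := hsub t ht (by
        change t • v - t • v ∈ ProperCone.innerDual F₀.carrier
        rw [sub_self]
        exact (ProperCone.innerDual F₀.carrier).zero_mem)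
      rwa [smul_neg, ← sub_eq_add_neg]
    have hv0 : v = 0 := inner_self_eq_zero.1
      (ProperCone.mem_orthogonal_of_mem_innerDual hvdual hvneg v hvspan)
    rw [hv0] at hv1
    simp at hv1

/-- The parameter space `{(F, x) | F ∈ S, x ∈ F^⊛}` of the set `{x - F^* | F ∈ S, x ∈ F^⊛}`. -/
def _root_.relDualBundle (S : Set (ClosedSubset X)) : Set (ClosedSubset X × X) :=
  {p | p.1 ∈ S ∧ p.2 ∈ relDual p.1.carrier}

theorem isEmbedding_subDual (hS : IsFaceStratum K S) :
    IsEmbedding fun p : relDualBundle S => subDual p.1.2 p.1.1.carrier := by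
  refine ⟨isInducing_iff_nhds.2 fun p => le_antisymm ?_ ?_, ?_⟩
  · rw [← tendsto_iff_comap]
    exact ProperCone.tendsto_subDual (Eventually.of_forall fun q => hS.mem_cones q.2.1)
      (continuous_fst.comp continuous_subtype_val).continuousAt
      (continuous_snd.comp continuous_subtype_val).continuousAt
  · refine le_iff_ultrafilter.2 fun 𝒰 h𝒰 => ?_
    rw [← tendsto_iff_comap] at h𝒰
    obtain ⟨h₁, h₂⟩ := hS.tendsto_of_tendsto_subDual 𝒰 (F := fun q : relDualBundle S => q.1.1)
      (x := fun q => q.1.2) (fun q => q.2.1) (fun q => q.2.2) p.2.1 p.2.2 h𝒰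
    exact tendsto_subtype_rng.2 (h₁.prodMk_nhds h₂)
  · intro p q hpq
    obtain ⟨h₁, h₂⟩ := ProperCone.eq_and_sub_mem_of_subDual_eq (hS.mem_cones p.2.1)
      (hS.mem_cones q.2.1) hpq
    have hspan : p.1.2 - q.1.2 ∈ Submodule.span ℝ p.1.1.carrier :=
      Submodule.sub_mem _ p.2.2.1 (by rw [h₁]; exact q.2.2.1)
    exact Subtype.ext (Prod.ext h₁ (sub_eq_zero.1 (inner_self_eq_zero.1 (h₂ _ hspan))))

theorem isClosed_relDualBundle (hS : IsFaceStratum K S) : IsClosed (relDualBundle S) := by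
  refine isClosed_iff_ultrafilter.2 fun p 𝒰 h𝒰 hmem => ?_
  have h₁ : Tendsto (fun q : ClosedSubset X × X => q.1) 𝒰 (𝓝 p.1) :=
    (continuous_fst.tendsto p).mono_left h𝒰
  have h₂ : Tendsto (fun q : ClosedSubset X × X => q.2) 𝒰 (𝓝 p.2) :=
    (continuous_snd.tendsto p).mono_left h𝒰
  have hev : ∀ᶠ q in (𝒰 : Filter _), q ∈ relDualBundle S := hmem
  have hp : p.1 ∈ S := hS.isCompact.isClosed.mem_of_tendsto h₁ (hev.mono fun q hq => hq.1)
  exact ⟨hp, mem_span_of_tendsto h₁ h₂ (hev.mono fun q hq => hS.spanDim_eq _ hq.1 _ hp)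
    (hev.mono fun q hq => hq.2.1),
    mem_innerDual_of_tendsto (hev.mono fun q hq => hS.mem_cones hq.1) h₁ h₂
      (hev.mono fun q hq => hq.2.2)⟩

theorem locallyCompactSpace_relDualBundle (hS : IsFaceStratum K S) :
    LocallyCompactSpace (relDualBundle S) := by
  have : WeaklyLocallyCompactSpace (relDualBundle S) := ⟨fun p => by
    refine ⟨Subtype.val ⁻¹' (S ×ˢ Metric.closedBall p.1.2 1),
      hS.isClosed_relDualBundle.isClosedEmbedding_subtypeVal.isCompact_preimage
        (hS.isCompact.prod (isCompact_closedBall _ _)), ?_⟩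
    have h : (fun q : relDualBundle S => q.1.2) ⁻¹' Metric.closedBall p.1.2 1 ∈ 𝓝 p :=
      (continuous_snd.comp continuous_subtype_val).continuousAt
        (Metric.closedBall_mem_nhds _ one_pos)
    filter_upwards [h] with q hq using ⟨q.2.1, hq⟩⟩
  infer_instance

end IsFaceStratum

end Strata

/-! ### The strata of units, their transversals and the group bundles -/

section Transversal

variable {X : Type*} [NormedAddCommGroup X] [InnerProductSpace ℝ X] [FiniteDimensional ℝ X]
variable {Ω : ProperCone ℝ X}

theorem isConvexFace_of_mem_dualFaces {F : ClosedSubset X} (hF : F ∈ dualFaces Ω) :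
    IsConvexFace (ProperCone.innerDual (Ω : Set X) : Set X) F := hF

/-- For the largest face `Ω^*` the points `x - F^*` are the original `η(x)`; this starts the descent
through faces. -/
theorem subDual_innerDual (x : X) :
    subDual x (ProperCone.innerDual (Ω : Set X) : Set X) = coneEmbedding Ω x := by
  ext z
  change x - z ∈ ProperCone.innerDual (ProperCone.innerDual (Ω : Set X) : Set X) ↔ x - z ∈ Ω
  rw [ProperCone.innerDual_innerDual]

omit [FiniteDimensional ℝ X] in
theorem mem_coneClosure_iff {ω : orderCompactification Ω} :
    ω ∈ coneClosure Ω ↔ ω.1 ∈ closure (coneEmbedding Ω '' (Ω : Set X)) := by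
  have h : Subtype.val '' {A : orderCompactification Ω |
      ∃ x ∈ Ω, (A : ClosedSubset X) = coneEmbedding Ω x} = coneEmbedding Ω '' (Ω : Set X) := by
    ext B
    constructor
    · rintro ⟨A, ⟨x, hx, hA⟩, rfl⟩
      exact ⟨x, hx, hA.symm⟩
    · rintro ⟨x, hx, rfl⟩
      exact ⟨⟨coneEmbedding Ω x, subset_closure ⟨x, rfl⟩⟩, ⟨x, hx, rfl⟩, rfl⟩
  rw [coneClosure, closure_subtype, h]

theorem exists_coneClosure_eq_subDual {F : ClosedSubset X} (hF : F ∈ dualFaces Ω) {x : X}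
    (hx : x ∈ ProperCone.innerDual F.carrier) :
    ∃ ω : coneClosure Ω, ω.1.1 = subDual x F.carrier := by
  have h : subDual x F.carrier ∈ closure (coneEmbedding Ω '' (Ω : Set X)) := by
    refine IsConvexFace.subDual_mem_of_isClosed isClosed_closure (fun y hy => ?_)
      (isConvexFace_of_mem_dualFaces hF) x hx
    rw [ProperCone.innerDual_innerDual] at hy
    rw [subDual_innerDual]
    exact subset_closure ⟨y, hy, rfl⟩
  exact ⟨⟨⟨_, closure_mono (image_subset_range _ _) h⟩, mem_coneClosure_iff.2 h⟩, rfl⟩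

omit [FiniteDimensional ℝ X] in
theorem zero_mem_of_mem_coneClosure {ω : orderCompactification Ω} (hω : ω ∈ coneClosure Ω) :
    0 ∈ ω.1.carrier := by
  refine closure_minimal ?_ (ClosedSubset.isClosed_mem 0) (mem_coneClosure_iff.1 hω)
  rintro _ ⟨x, hx, rfl⟩
  change x - 0 ∈ Ω
  rwa [sub_zero]

/-- A point `x - F^*` which contains the origin is of the form `x' - F^*` with `x' ∈ F^⊛`. -/
theorem exists_mem_relDual {F : Set X} {x : X} (h : 0 ∈ (subDual x F).carrier) :
    ∃ x' ∈ relDual F, subDual x F = subDual x' F := by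
  have hx : x - 0 ∈ ProperCone.innerDual F := h
  rw [sub_zero] at hx
  have hperp := Submodule.sub_starProjection_mem_orthogonal (K := Submodule.span ℝ F) x
  refine ⟨(Submodule.span ℝ F).starProjection x, ⟨Submodule.starProjection_apply_mem _ _, ?_⟩,
    ProperCone.subDual_eq_of_sub_mem hperp⟩
  have h₁ := (ProperCone.innerDual F).add_mem hx
    (ProperCone.mem_innerDual_of_mem_orthogonal (Submodule.neg_mem _ hperp))
  rwa [show x + -(x - (Submodule.span ℝ F).starProjection x) =
    (Submodule.span ℝ F).starProjection x by abel] at h₁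

/-- No condition on `x` is needed: points of `Ω̄` contain the origin, so `x ∈ F^*`, and its
projection to `span F` lies in `F^⊛`. -/
theorem mem_unitStratum_of_eq {j : ℕ} {F : ClosedSubset X} (hF : F ∈ faceStratum Ω j) {x : X}
    {ω : coneClosure Ω} (h : ω.1.1 = subDual x F.carrier) : ω ∈ unitStratum Ω j := by
  obtain ⟨x', hx', he⟩ := exists_mem_relDual (h ▸ zero_mem_of_mem_coneClosure ω.2)
  exact ⟨F, hF, x', hx', h.trans he⟩

theorem isInvariant_unitStratum (j : ℕ) : (wienerHopf Ω).IsInvariant (unitStratum Ω j) := by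
  intro g
  have hs : ((wienerHopf Ω).s g).1.1 = g.1.2 +ᵥ ((wienerHopf Ω).r g).1.1 := rfl
  constructor
  · rintro ⟨F, hF, x, -, h⟩
    exact mem_unitStratum_of_eq hF (by rw [hs, h, ProperCone.vadd_subDual])
  · rintro ⟨F, hF, x, -, h⟩
    refine mem_unitStratum_of_eq hF (x := -g.1.2 + x) ?_
    rw [← ProperCone.vadd_subDual, ← h, hs, neg_vadd_vadd]

theorem finite_faceDims (Ω : ProperCone ℝ X) : (faceDims Ω).Finite := by
  refine (Set.finite_Iic (Module.finrank ℝ X)).subset ?_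
  rintro _ ⟨F, -, rfl⟩
  exact Submodule.finrank_le _

theorem exists_mem_faceStratum {F : ClosedSubset X} (hF : F ∈ dualFaces Ω) :
    ∃ j ≤ faceDepth Ω, F ∈ faceStratum Ω j := by
  have hfin : (Set.ofPred fun n => n ∈ faceDims Ω).Finite := finite_faceDims Ω
  obtain ⟨n, hn, hnF⟩ := Nat.exists_lt_card_finite_nth_eq hfin
    (x := spanDim F.carrier) ⟨F, hF, rfl⟩
  have hcard : hfin.toFinset.card = (faceDims Ω).ncard :=
    (Set.ncard_eq_toFinset_card _ hfin).symm
  -- The index `n` starts at `0`, so `n < ncard` gives `n ≤ faceDepth Ω`, and truncated subtraction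
  -- then returns `n` from `d - (d - n)`.
  refine ⟨faceDepth Ω - n, Nat.sub_le _ _, hF, ?_⟩
  rw [← hnF, Nat.sub_sub_self]
  rw [hcard] at hn
  exact Nat.le_sub_one_of_lt hn

theorem isCompact_dualFaces (hc : ∀ j ≤ faceDepth Ω, IsCompact (faceStratum Ω j)) :
    IsCompact (dualFaces Ω) := by
  have h : dualFaces Ω = ⋃ j ∈ Set.Iic (faceDepth Ω), faceStratum Ω j := by
    ext F
    simp only [mem_iUnion, mem_Iic, exists_prop]
    exact ⟨exists_mem_faceStratum, fun ⟨_, _, hF⟩ => hF.1⟩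
  rw [h]
  exact (Set.finite_Iic _).isCompact_biUnion hc

theorem isFaceStratum_faceStratum {j : ℕ} (hc : IsCompact (faceStratum Ω j)) :
    IsFaceStratum (ProperCone.innerDual (Ω : Set X)) (faceStratum Ω j) where
  isCompact := hc
  isConvexFace _ hF := isConvexFace_of_mem_dualFaces hF.1
  spanDim_eq _ hF _ hF' := hF.2.trans hF'.2.symm

/-- A continuous injection of a compact space into a Hausdorff space. -/
theorem isClosedEmbedding_subDual_zero {S : Set (ClosedSubset X)} (hS : IsCompact S)
    (hcone : S ⊆ ClosedSubset.cones X) :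
    IsClosedEmbedding fun F : S => subDual 0 F.1.carrier := by
  have : CompactSpace S := isCompact_iff_compactSpace.1 hS
  refine Continuous.isClosedEmbedding (continuous_iff_continuousAt.2 fun F => ?_) fun F F' h => ?_
  · exact ProperCone.tendsto_subDual_zero (Eventually.of_forall fun F' : S => hcone F'.2)
      continuous_subtype_val.continuousAt
  · exact Subtype.ext (ProperCone.eq_and_sub_mem_of_subDual_eq (hcone F.2) (hcone F'.2) h).1

theorem dualFaces_subset_cones : dualFaces Ω ⊆ ClosedSubset.cones X :=
  fun _ hF => (isConvexFace_of_mem_dualFaces hF).mem_cones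

theorem faceStratum_subset_cones (j : ℕ) : faceStratum Ω j ⊆ ClosedSubset.cones X :=
  fun _ hF => dualFaces_subset_cones hF.1

theorem exists_isClosedEmbedding_dualFaces
    (hc : ∀ j ≤ faceDepth Ω, IsCompact (faceStratum Ω j)) :
    ∃ ι : dualFaces Ω → coneClosure Ω,
      (∀ F, (ι F).1.1 = subDual 0 F.1.carrier) ∧ IsClosedEmbedding ι := by
  choose ι hι using fun F : dualFaces Ω =>
    exists_coneClosure_eq_subDual F.2 (ProperCone.innerDual F.1.carrier).zero_mem
  refine ⟨ι, hι, ?_⟩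
  have h := isClosedEmbedding_subDual_zero (isCompact_dualFaces hc) dualFaces_subset_cones
  have hval : IsEmbedding fun ω : coneClosure Ω => ω.1.1 :=
    IsEmbedding.subtypeVal.comp IsEmbedding.subtypeVal
  have hcomp : (fun ω : coneClosure Ω => ω.1.1) ∘ ι = fun F => subDual 0 F.1.carrier := funext hι
  exact IsClosedEmbedding.of_comp hval (hcomp ▸ h)

variable {j : ℕ}

theorem isEmbedding_unitStratum (Ω : ProperCone ℝ X) (j : ℕ) :
    IsEmbedding fun ω : unitStratum Ω j => ω.1.1.1 :=
  (IsEmbedding.subtypeVal.comp IsEmbedding.subtypeVal).comp IsEmbedding.subtypeVal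

/-- The coordinates `(F, x)` of the points `x - F^*` of a stratum of units. -/
theorem exists_homeomorph_relDualBundle (hc : IsCompact (faceStratum Ω j)) :
    ∃ e : unitStratum Ω j ≃ₜ relDualBundle (faceStratum Ω j),
      ∀ ω, ω.1.1.1 = subDual (e ω).1.2 (e ω).1.1.carrier := by
  choose f hf using fun p : relDualBundle (faceStratum Ω j) =>
    exists_coneClosure_eq_subDual p.2.1.1 p.2.2.2
  let k : relDualBundle (faceStratum Ω j) → unitStratum Ω j := fun p =>
    ⟨f p, p.1.1, p.2.1, p.1.2, p.2.2, hf p⟩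
  have hk : ∀ p, (k p).1.1.1 = subDual p.1.2 p.1.1.carrier := hf
  have hcomp : (fun ω : unitStratum Ω j => ω.1.1.1) ∘ k =
      fun p => subDual p.1.2 p.1.1.carrier := funext hk
  have hemb : IsEmbedding k := by
    refine (isEmbedding_unitStratum Ω j).of_comp_iff.1 ?_
    rw [hcomp]
    exact (isFaceStratum_faceStratum hc).isEmbedding_subDual
  have hsurj : Function.Surjective k := by
    rintro ⟨ω, F, hF, x, hx, h⟩
    exact ⟨⟨(F, x), hF, hx⟩, (isEmbedding_unitStratum Ω j).injective ((hk _).trans h.symm)⟩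
  let e := hemb.toHomeomorphOfSurjective hsurj
  refine ⟨e.symm, fun ω => ?_⟩
  rw [← hk (e.symm ω)]
  exact congrArg (fun ω : unitStratum Ω j => ω.1.1.1) (e.apply_symm_apply ω).symm

variable (Ω j) in
/-- The arrow space of the restricted groupoid `𝒲_Ω|Y_j`. -/
abbrev StratumArrow : Type _ :=
  {g : {g : orderCompactification Ω × X //
    (TopGroupoid.transformation X (orderCompactification Ω)).r g ∈ coneClosure Ω ∧
      (TopGroupoid.transformation X (orderCompactification Ω)).s g ∈ coneClosure Ω} //
    (wienerHopf Ω).r g ∈ unitStratum Ω j ∧ (wienerHopf Ω).s g ∈ unitStratum Ω j}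

theorem isEmbedding_stratumArrow (Ω : ProperCone ℝ X) (j : ℕ) :
    IsEmbedding fun g : StratumArrow Ω j => (g.1.1.1.1, g.1.1.2) :=
  ((IsEmbedding.subtypeVal.prodMap IsEmbedding.id).comp IsEmbedding.subtypeVal).comp
    IsEmbedding.subtypeVal

theorem stratumGroupoid_s (g : StratumArrow Ω j) :
    ((stratumGroupoid Ω j).s g).1.1.1 = g.1.1.2 +ᵥ g.1.1.1.1 := rfl

/-- By invariance of `Y_j`, a pair `(ω, y)` with `ω ∈ Y_j` is an arrow exactly when the translate is
in `Ω̄`, a closed condition. Local compactness of `Y_j × X` thus passes to the arrows. -/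
theorem isClosedEmbedding_stratumArrow (Ω : ProperCone ℝ X) (j : ℕ) :
    IsClosedEmbedding fun g : StratumArrow Ω j => ((stratumGroupoid Ω j).r g, g.1.1.2) := by
  have hemb : IsEmbedding fun g : StratumArrow Ω j => ((stratumGroupoid Ω j).r g, g.1.1.2) :=
    ((isEmbedding_unitStratum Ω j).prodMap (IsEmbedding.id (X := X))).of_comp_iff.1
      (isEmbedding_stratumArrow Ω j)
  refine ⟨hemb, ?_⟩
  have hrange : range (fun g : StratumArrow Ω j => ((stratumGroupoid Ω j).r g, g.1.1.2)) =
      {p : unitStratum Ω j × X | p.2 +ᵥ p.1.1.1 ∈ coneClosure Ω} := by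
    ext ⟨ω, y⟩
    constructor
    · rintro ⟨g, hg⟩
      cases hg
      exact g.1.2.2
    · intro h
      exact ⟨⟨⟨(ω.1.1, y), ω.1.2, h⟩, ω.2, (isInvariant_unitStratum j _).1 ω.2⟩, rfl⟩
  rw [hrange]
  refine IsClosed.preimage ?_ (isClosed_closure : IsClosed (coneClosure Ω))
  fun_prop

theorem locallyCompactSpace_stratumArrow (hc : IsCompact (faceStratum Ω j)) :
    LocallyCompactSpace (StratumArrow Ω j) := by
  obtain ⟨e, -⟩ := exists_homeomorph_relDualBundle hc
  have := (isFaceStratum_faceStratum hc).locallyCompactSpace_relDualBundle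
  have : LocallyCompactSpace (unitStratum Ω j) := e.isClosedEmbedding.locallyCompactSpace
  exact (isClosedEmbedding_stratumArrow Ω j).locallyCompactSpace

theorem exists_stratumArrow {F : ClosedSubset X} (hF : F ∈ faceStratum Ω j) {z y : X}
    (hz : z ∈ ProperCone.innerDual F.carrier) (hy : y + z ∈ ProperCone.innerDual F.carrier) :
    ∃ g : StratumArrow Ω j, (g.1.1.1.1, g.1.1.2) = (subDual z F.carrier, y) := by
  obtain ⟨ω, hω⟩ := exists_coneClosure_eq_subDual hF.1 hz
  obtain ⟨ω', hω'⟩ := exists_coneClosure_eq_subDual hF.1 hy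
  have h : y +ᵥ ω.1 = ω'.1 := Subtype.ext (by
    change y +ᵥ ω.1.1 = ω'.1.1
    rw [hω, hω', ProperCone.vadd_subDual])
  have hmem : y +ᵥ ω.1 ∈ coneClosure Ω := h ▸ ω'.2
  have hY := mem_unitStratum_of_eq hF hω
  exact ⟨⟨⟨(ω.1, y), ω.2, hmem⟩, hY, (isInvariant_unitStratum j _).1 hY⟩, by rw [← hω]⟩

/-- Produces the arrows ending on the transversal: translation by `y` takes `z - F^*` to `-F^*` when
`y + z ∈ F^⊥`. -/
theorem exists_sourceFibre {F : ClosedSubset X} (hF : F ∈ faceStratum Ω j) {z y : X}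
    (hz : z ∈ ProperCone.innerDual F.carrier) (hy : y + z ∈ (Submodule.span ℝ F.carrier)ᗮ) :
    ∃ m : (stratumGroupoid Ω j).SourceFibre (faceUnits Ω j),
      (m.1.1.1.1.1, m.1.1.1.2) = (subDual z F.carrier, y) ∧
        ((stratumGroupoid Ω j).s m.1).1.1.1 = subDual 0 F.carrier := by
  obtain ⟨g, hg⟩ := exists_stratumArrow hF hz (ProperCone.mem_innerDual_of_mem_orthogonal hy)
  have hs : ((stratumGroupoid Ω j).s g).1.1.1 = subDual 0 F.carrier := by
    obtain ⟨h₁, h₂⟩ := Prod.mk.inj hg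
    rw [stratumGroupoid_s, h₁, h₂, ProperCone.vadd_subDual]
    exact ProperCone.subDual_eq_of_sub_mem (by rwa [sub_zero])
  exact ⟨⟨g, F, hF, hs⟩, hg, hs⟩

theorem isEmbedding_sourceFibre (Ω : ProperCone ℝ X) (j : ℕ) :
    IsEmbedding fun m : (stratumGroupoid Ω j).SourceFibre (faceUnits Ω j) =>
      (m.1.1.1.1.1, m.1.1.1.2) :=
  (isEmbedding_stratumArrow Ω j).comp IsEmbedding.subtypeVal

theorem isAbstractTransversal_faceUnits (hc : IsCompact (faceStratum Ω j)) :
    (stratumGroupoid Ω j).IsAbstractTransversal (faceUnits Ω j) := by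
  obtain ⟨e, he⟩ := exists_homeomorph_relDualBundle hc
  have hS := isFaceStratum_faceStratum hc
  have hcont₁ : Continuous fun ω => (e ω).1.1 :=
    continuous_fst.comp (continuous_subtype_val.comp e.continuous)
  have hcont₂ : Continuous fun ω => (e ω).1.2 :=
    continuous_snd.comp (continuous_subtype_val.comp e.continuous)
  have hcoord : ∀ ω : unitStratum Ω j, ∀ F ∈ faceStratum Ω j, ∀ x,
      ω.1.1.1 = subDual x F.carrier →
        (e ω).1.1 = F ∧ (e ω).1.2 - x ∈ (Submodule.span ℝ F.carrier)ᗮ := by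
    intro ω F hF x h
    obtain ⟨h₁, h₂⟩ := ProperCone.eq_and_sub_mem_of_subDual_eq (hS.mem_cones (e ω).2.1)
      (hS.mem_cones hF) ((he ω).symm.trans h)
    exact ⟨h₁, h₁ ▸ h₂⟩
  refine ⟨?_, fun ω => ?_, ?_, ?_⟩
  · have h : faceUnits Ω j = {ω | (e ω).1.2 = 0} := by
      ext ω
      constructor
      · rintro ⟨F, hF, h⟩
        obtain ⟨h₁, h₂⟩ := hcoord ω F hF 0 h
        rw [sub_zero] at h₂
        exact inner_self_eq_zero.1 (h₂ _ (h₁ ▸ (e ω).2.2.1))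
      · intro h
        refine ⟨(e ω).1.1, (e ω).2.1, ?_⟩
        have h' := he ω
        rwa [show (e ω).1.2 = 0 from h] at h'
    rw [h]
    exact isClosed_eq hcont₂ continuous_const
  · obtain ⟨m, hm, -⟩ := exists_sourceFibre (e ω).2.1 (e ω).2.2.2 (y := -(e ω).1.2)
      (by rw [neg_add_cancel]; exact Submodule.zero_mem _)
    exact ⟨m.1, (isEmbedding_unitStratum Ω j).injective ((Prod.ext_iff.1 hm).1.trans (he ω).symm),
      m.2⟩
  · refine IsOpenMap.of_sections fun m => ?_
    obtain ⟨F₀, hF₀, hs⟩ := m.2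
    set ω₀ := (stratumGroupoid Ω j).r m.1 with hω₀
    set y₀ := m.1.1.1.2 with hy₀
    have hr : ω₀.1.1.1 = subDual (-y₀) F₀.carrier := by
      rw [stratumGroupoid_s] at hs
      change m.1.1.1.1.1 = _
      rw [← neg_vadd_vadd y₀ m.1.1.1.1.1, hs, ProperCone.vadd_subDual, add_zero]
    obtain ⟨h₁, h₂⟩ := hcoord ω₀ F₀ hF₀ (-y₀) hr
    rw [sub_neg_eq_add] at h₂
    -- This is the `F₀^⊥` part of the given arrow. For other `F`, removing its projection to `span
    -- F` puts it in `F^⊥`, and `u - p ω - x` is then an arrow from `(F, x)` to `(F, 0)`, equal to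
    -- `y₀` at `ω₀`.
    let u : X := (e ω₀).1.2 + y₀
    let p : unitStratum Ω j → X := fun ω => (Submodule.span ℝ (e ω).1.1.carrier).starProjection u
    choose σ hσ hσs using fun ω : unitStratum Ω j => exists_sourceFibre (e ω).2.1 (e ω).2.2.2
      (y := u - p ω - (e ω).1.2) (by
        rw [sub_add_cancel]
        exact Submodule.sub_starProjection_mem_orthogonal _)
    have hp₀ : p ω₀ = 0 := by
      refine Submodule.eq_starProjection_of_mem_orthogonal (Submodule.zero_mem _) ?_
      rw [sub_zero, h₁]
      exact h₂
    refine ⟨σ, ?_, ?_, fun ω => ?_⟩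
    · rw [(isEmbedding_sourceFibre Ω j).isInducing.continuousAt_iff]
      have hfun : (fun m : (stratumGroupoid Ω j).SourceFibre (faceUnits Ω j) =>
          (m.1.1.1.1.1, m.1.1.1.2)) ∘ σ = fun ω => (ω.1.1.1, u - p ω - (e ω).1.2) :=
        funext fun ω => (hσ ω).trans (by rw [he ω])
      rw [hfun]
      refine (isEmbedding_unitStratum Ω j).continuous.continuousAt.prodMk
        ((continuousAt_const.sub ?_).sub hcont₂.continuousAt)
      exact tendsto_starProjection_span (Eventually.of_forall fun ω => hS.mem_cones (e ω).2.1)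
        hcont₁.continuousAt
        (Eventually.of_forall fun ω => hS.spanDim_eq _ (e ω).2.1 _ (e _).2.1) u
    · refine (isEmbedding_sourceFibre Ω j).injective ((hσ _).trans ?_)
      refine Prod.ext (he ω₀).symm ?_
      change u - p ω₀ - (e ω₀).1.2 = y₀
      rw [hp₀]
      change (e ω₀).1.2 + y₀ - 0 - (e ω₀).1.2 = y₀
      abel
    · exact (isEmbedding_unitStratum Ω j).injective ((Prod.ext_iff.1 (hσ ω)).1.trans (he ω).symm)
  · refine IsOpenMap.of_sections fun m => ?_
    obtain ⟨F₀, hF₀, hs⟩ := m.2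
    set ω₀ : faceUnits Ω j := ⟨(stratumGroupoid Ω j).s m.1, m.2⟩ with hω₀
    set y₀ := m.1.1.1.2 with hy₀
    have hr : m.1.1.1.1.1 = subDual (-y₀) F₀.carrier := by
      rw [stratumGroupoid_s] at hs
      rw [← neg_vadd_vadd y₀ m.1.1.1.1.1, hs, ProperCone.vadd_subDual, add_zero]
    have hz : -y₀ ∈ ProperCone.innerDual F₀.carrier := by
      have h0 : 0 ∈ (subDual (-y₀) F₀.carrier).carrier :=
        hr ▸ zero_mem_of_mem_coneClosure m.1.1.2.1
      have h0' : -y₀ - 0 ∈ ProperCone.innerDual F₀.carrier := h0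
      rwa [sub_zero] at h0'
    -- The range of the given arrow is `-y₀ - F₀^*`. Moving `-y₀` to nearby points `q F ∈ F^*` gives
    -- arrows from `q F - F^*` to `-F^*` by translation through `-q F`.
    obtain ⟨q, hq, hq₀, hqt⟩ := exists_tendsto_mem_innerDual hz
    have hF₀e : (e ω₀.1).1.1 = F₀ := (hcoord ω₀.1 F₀ hF₀ 0 hs).1
    choose σ hσ hσs using fun ω : faceUnits Ω j =>
      exists_sourceFibre (e ω.1).2.1 (hq (e ω.1).1.1) (y := -q (e ω.1).1.1) (by
        rw [neg_add_cancel]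
        exact Submodule.zero_mem _)
    have hqc : Tendsto (fun ω : faceUnits Ω j => q (e ω.1).1.1) (𝓝 ω₀) (𝓝 (-y₀)) := by
      refine hqt.comp (tendsto_nhdsWithin_iff.2 ⟨?_,
        Eventually.of_forall fun ω => hS.mem_cones (e ω.1).2.1⟩)
      rw [← hF₀e]
      exact (hcont₁.comp continuous_subtype_val).continuousAt
    refine ⟨σ, ?_, ?_, fun ω => ?_⟩
    · rw [(isEmbedding_sourceFibre Ω j).isInducing.continuousAt_iff]
      have hfun : (fun m : (stratumGroupoid Ω j).SourceFibre (faceUnits Ω j) =>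
          (m.1.1.1.1.1, m.1.1.1.2)) ∘ σ =
            fun ω => (subDual (q (e ω.1).1.1) (e ω.1).1.1.carrier, -q (e ω.1).1.1) :=
        funext hσ
      have hqc' : ContinuousAt (fun ω : faceUnits Ω j => q (e ω.1).1.1) ω₀ := by
        rw [ContinuousAt, hF₀e, hq₀]
        exact hqc
      rw [hfun]
      refine ContinuousAt.prodMk ?_ hqc'.neg
      exact ProperCone.tendsto_subDual (Eventually.of_forall fun ω => hS.mem_cones (e ω.1).2.1)
        (hcont₁.comp continuous_subtype_val).continuousAt hqc'
    · refine (isEmbedding_sourceFibre Ω j).injective ((hσ _).trans ?_)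
      rw [hF₀e, hq₀, neg_neg, ← hr]
    · obtain ⟨F, hF, hωF⟩ := ω.2
      have hFe := (hcoord ω.1 F hF 0 hωF).1
      refine Subtype.ext ((isEmbedding_unitStratum Ω j).injective ((hσs ω).trans ?_))
      rw [hFe]
      exact hωF.symm

/-- The arrows over the transversal do not change the base point. -/
theorem stratumBundle_arrow {F F' : ClosedSubset X} (hF : F ∈ faceStratum Ω j)
    (hF' : F' ∈ faceStratum Ω j) {y : X}
    (h : y +ᵥ subDual 0 F.carrier = subDual 0 F'.carrier) :
    F = F' ∧ y ∈ (Submodule.span ℝ F.carrier)ᗮ := by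
  rw [ProperCone.vadd_subDual, add_zero] at h
  obtain ⟨h₁, h₂⟩ := ProperCone.eq_and_sub_mem_of_subDual_eq (faceStratum_subset_cones j hF)
    (faceStratum_subset_cones j hF') h
  rw [sub_zero] at h₂
  exact ⟨h₁, h₂⟩

theorem stratumBundle_r_eq_s (g) : (stratumBundle Ω j).r g = (stratumBundle Ω j).s g := by
  obtain ⟨F, hF, hr⟩ := g.2.1
  obtain ⟨F', hF', hs⟩ := g.2.2
  refine Subtype.ext ((isEmbedding_unitStratum Ω j).injective ?_)
  change ((stratumGroupoid Ω j).r g.1).1.1.1 = ((stratumGroupoid Ω j).s g.1).1.1.1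
  have hs' := hs
  rw [stratumGroupoid_s, show g.1.1.1.1.1 = subDual 0 F.carrier from hr] at hs'
  rw [hr, hs, (stratumBundle_arrow hF hF' hs').1]

theorem isEmbedding_stratumBundle (Ω : ProperCone ℝ X) (j : ℕ) :
    IsEmbedding fun g : {g : StratumArrow Ω j // (stratumGroupoid Ω j).r g ∈ faceUnits Ω j ∧
      (stratumGroupoid Ω j).s g ∈ faceUnits Ω j} => (g.1.1.1.1.1, g.1.1.1.2) :=
  (isEmbedding_stratumArrow Ω j).comp IsEmbedding.subtypeVal

theorem isAbelianGroupBundle_stratumBundle (Ω : ProperCone ℝ X) (j : ℕ) :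
    (stratumBundle Ω j).IsAbelianGroupBundle where
  r_eq_s := stratumBundle_r_eq_s
  mul_comm g h e e' := by
    refine (isEmbedding_stratumBundle Ω j).injective (Prod.ext ?_ (add_comm _ _))
    have hgh : (stratumBundle Ω j).r g = (stratumBundle Ω j).r h :=
      (stratumBundle_r_eq_s g).trans e
    exact congrArg (fun ω : faceUnits Ω j => ω.1.1.1.1) hgh

/-- The bundle `𝒲_Ω|P_j` is isomorphic to the co-tautological bundle over `P_j`. -/
theorem exists_iso_stratumBundle (hc : IsCompact (faceStratum Ω j)) :
    ∃ φ : TopGroupoid.Iso (perpBundle (faceStratum Ω j)) (stratumBundle Ω j),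
      (∀ F, (φ.units F).1.1.1.1 = subDual 0 F.1.carrier) ∧
      ∀ p, (φ.arrows p).1.1.1.1.1 = subDual 0 p.1.1.1.carrier ∧
        (φ.arrows p).1.1.1.2 = p.1.2 := by
  have hU := (isClosedEmbedding_subDual_zero hc (faceStratum_subset_cones j)).isEmbedding
  have hV : IsEmbedding fun ω : faceUnits Ω j => ω.1.1.1.1 :=
    (isEmbedding_unitStratum Ω j).comp IsEmbedding.subtypeVal
  choose a ha using fun F : faceStratum Ω j =>
    exists_coneClosure_eq_subDual F.2.1 (ProperCone.innerDual F.1.carrier).zero_mem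
  let f : faceStratum Ω j → faceUnits Ω j := fun F =>
    ⟨⟨a F, mem_unitStratum_of_eq F.2 (ha F)⟩, F.1, F.2, ha F⟩
  have hfemb : IsEmbedding f := by
    refine hV.of_comp_iff.1 ?_
    rw [show (fun ω : faceUnits Ω j => ω.1.1.1.1) ∘ f =
      fun F : faceStratum Ω j => subDual 0 F.1.carrier from funext ha]
    exact hU
  have hfsurj : Function.Surjective f := by
    rintro ⟨ω, F, hF, h⟩
    exact ⟨⟨F, hF⟩, hV.injective ((ha _).trans h.symm)⟩
  -- The pair `(F, y)` becomes the arrow with range `-F^*` and translation `y`, which ends on the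
  -- transversal since `y ∈ F^⊥`.
  choose b hb hbs using fun p : {p : faceStratum Ω j × X //
      p.2 ∈ (Submodule.span ℝ p.1.1.carrier)ᗮ} =>
    exists_sourceFibre p.1.1.2 (ProperCone.innerDual p.1.1.1.carrier).zero_mem (y := p.1.2)
      (by rw [add_zero]; exact p.2)
  let k : {p : faceStratum Ω j × X // p.2 ∈ (Submodule.span ℝ p.1.1.carrier)ᗮ} →
      {g : StratumArrow Ω j // (stratumGroupoid Ω j).r g ∈ faceUnits Ω j ∧
        (stratumGroupoid Ω j).s g ∈ faceUnits Ω j} := fun p =>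
    ⟨(b p).1, ⟨p.1.1.1, p.1.1.2, (Prod.ext_iff.1 (hb p)).1⟩, (b p).2⟩
  have hkemb : IsEmbedding k := by
    refine (isEmbedding_stratumBundle Ω j).of_comp_iff.1 ?_
    rw [show (fun g : {g : StratumArrow Ω j // (stratumGroupoid Ω j).r g ∈ faceUnits Ω j ∧
      (stratumGroupoid Ω j).s g ∈ faceUnits Ω j} => (g.1.1.1.1.1, g.1.1.1.2)) ∘ k =
        fun p => (subDual 0 p.1.1.1.carrier, p.1.2) from funext hb]
    exact (hU.prodMap IsEmbedding.id).comp IsEmbedding.subtypeVal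
  have hksurj : Function.Surjective k := by
    rintro ⟨g, ⟨F, hF, hr⟩, ⟨F', hF', hs⟩⟩
    have hr' : g.1.1.1.1 = subDual 0 F.carrier := hr
    rw [stratumGroupoid_s, hr'] at hs
    refine ⟨⟨(⟨F, hF⟩, g.1.1.2), (stratumBundle_arrow hF hF' hs).2⟩,
      (isEmbedding_stratumBundle Ω j).injective ((hb _).trans ?_)⟩
    exact Prod.ext hr'.symm rfl
  refine ⟨{
    arrows := hkemb.toHomeomorphOfSurjective hksurj
    units := hfemb.toHomeomorphOfSurjective hfsurj
    r_arrows := fun p => hV.injective ((Prod.ext_iff.1 (hb p)).1.trans (ha p.1.1).symm)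
    s_arrows := fun p => hV.injective ((hbs p).trans (ha p.1.1).symm)
    arrows_mul := fun p q e => (isEmbedding_stratumBundle Ω j).injective ((hb _).trans
      (Prod.ext (Prod.ext_iff.1 (hb p)).1.symm ?_)) }, ha, fun p => Prod.ext_iff.1 (hb p)⟩
  exact (congrArg₂ (· + ·) (Prod.ext_iff.1 (hb p)).2 (Prod.ext_iff.1 (hb q)).2).symm

end Transversal

end ConeFaces

theorem mainTheorem10 {X : Type*} [NormedAddCommGroup X] [InnerProductSpace ℝ X] [FiniteDimensional ℝ X]
    (Ω : ProperCone ℝ X)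
    (hpointed : ∀ x ∈ Ω, -x ∈ Ω → x = 0)
    (hsolid : ∀ x : X, ∃ a ∈ Ω, ∃ b ∈ Ω, x = a - b)
    (hcompact : ∀ j ≤ faceDepth Ω, IsCompact (faceStratum Ω j)) :
    -- all the sets `x - F^*`, `F ∈ P`, `x ∈ F^⊛`, are points of `Ω̄`
    (∀ F ∈ dualFaces Ω, ∀ x ∈ relDual F.carrier,
      ∃ ω : coneClosure Ω, ω.1.1 = subDual x F.carrier) ∧
    -- the embedding of `P`
    (∃ ι : dualFaces Ω → coneClosure Ω,
      (∀ F, (ι F).1.1 = subDual 0 F.1.carrier) ∧ IsClosedEmbedding ι) ∧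
    ∀ j ≤ faceDepth Ω,
      -- `Y_j` is invariant, so that `s⁻¹(P_j)` and the restriction to `P_j` are the same whether
      -- they are formed in `𝒲_Ω` or in `𝒲_Ω|Y_j`
      (wienerHopf Ω).IsInvariant (unitStratum Ω j) ∧
      (stratumGroupoid Ω j).IsAbstractTransversal (faceUnits Ω j) ∧
      TopGroupoid.IsEquivalence (stratumGroupoid Ω j) (stratumBundle Ω j)
        ((stratumGroupoid Ω j).leftMul (faceUnits Ω j))
        ((stratumGroupoid Ω j).rightMul (faceUnits Ω j)) ∧
      (stratumBundle Ω j).IsAbelianGroupBundle ∧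
      ∃ φ : TopGroupoid.Iso (perpBundle (faceStratum Ω j)) (stratumBundle Ω j),
        (∀ F, (φ.units F).1.1.1.1 = subDual 0 F.1.carrier) ∧
        ∀ p, (φ.arrows p).1.1.1.1.1 = subDual 0 p.1.1.1.carrier ∧
          (φ.arrows p).1.1.1.2 = p.1.2 := by
  refine ⟨fun F hF x hx => exists_coneClosure_eq_subDual hF hx.2,
    exists_isClosedEmbedding_dualFaces hcompact, fun j hj => ?_⟩
  have hc := hcompact j hj
  have hT := isAbstractTransversal_faceUnits hc
  have := locallyCompactSpace_stratumArrow hc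
  exact ⟨isInvariant_unitStratum j, hT, hT.isEquivalence, isAbelianGroupBundle_stratumBundle Ω j,
    exists_iso_stratumBundle hc⟩
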